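/- **Setting.** Let $\mathcal H$ be a complex Hilbert space, $A$ a (possibly unbounded) selfadjoint operator in $\mathcal H$, $B\neq 0$ a bounded selfadjoint operator on $\mathcal H$, $c\ge 0$ and $d>0$. Consider the rational operator function $$T(\omega)=A-\omega^2-\frac{\omega^2}{c-id\omega-\omega^2}B .$$ For an operator $S$ put $W(S)=\{(Su,u)/(u,u): u\in\operatorname{dom}S\setminus\{0\}\}\subset\mathbb R$. Let $\overline{\mathbb R}=[-\infty,\infty]$, let $\overline{\mathbb C}=\mathbb C\cup\{\infty\}$ be the Riemann sphere, and let $$\Omega=\overline{W(A)}\times\overline{W(B)}\subset\overline{\mathbb R}\times\mathbb R ,$$ where $\overline{W(A)}$ is the closure in $\overline{\mathbb R}$. For real $\alpha,\beta$ let $p_{(\alpha,\beta)}(\omega)=(\alpha-\omega^2)(c-id\omega-\omega^2)-\beta\omega^2$. For $X\subset\overline{\mathbb R}\times\mathbb R$ let $W_X(T)\subset\overline{\mathbb C}$ be the set of all roots of $p_{(\alpha,\beta)}$, $(\alpha,\beta)\in X$, where for $\alpha=\pm\infty$ the roots are understood as the limit values in $\overline{\mathbb C}$ of the roots of $p_{(\alpha',\beta)}$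 as the real number $\alpha'$ tends to $\alpha$. Let $\partial\Omega$ be the boundary of $\Omega$ in $\overline{\mathbb R}\times\mathbb R$, and write $$F=\overline{W_\Omega(T)\setminus i\mathbb R},\qquad G=\overline{W_{\partial\Omega}(T)\setminus i\mathbb R},$$ with closures in $\overline{\mathbb C}$ and $i\mathbb R=\{i\mu:\mu\in\mathbb R\}$ (so $\infty\notin i\mathbb R$). Two disjoint subsets of $\overline{\mathbb C}$ are called neighbors if the intersection of their boundaries contains a curve segment (a simple arc). **Proposition 2.19.** If $W(A)$ or $W(B)$ is a single point, then $F=G$. Otherwise exactly one component of $\overline{\mathbb C}\setminus G$ contains points $\omega\in\mathbb C$ with arbitrarily large $\operatorname{Im}\omega$, and $F$ is obtained from $G$ by the following algorithm, which stops after finitely many steps. 1. Let $\mathcal O$ be the component of $\overline{\mathbb C}\setminus G$ that contains points with arbitrarily large imaginary parts, and let $\mathcal I=\emptyset$. If $\mathcal I\cup\mathcal O=\overline{\mathbb C}\setminus G$, go to step 5. 2. Let $\mathcal I$ be the union of all components of $\overline{\mathbb C}\setminus G$ that are neighbors of $\mathcal O$. 3. Let $\mathcal O$ be the union of all components of $\overline{\mathbb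 C}\setminus G$ that are neighbors of $\mathcal I$. 4. If $\mathcal I\cup\mathcal O\neq\overline{\mathbb C}\setminus G$, go to step 2. 5. The result is $F=\mathcal I\cup G$. -/

import Mathlib

open Set Filter Topology

namespace RationalNumRange

/-- The Riemann sphere, the one-point compactification of the complex plane. -/
abbrev Sphere : Type := OnePoint ℂ

section Operators

variable {H : Type*} [NormedAddCommGroup H] [InnerProductSpace ℂ H]

/-- The numerical range of a symmetric, possibly unbounded, operator: the set of all real numbers
`(A u, u) / (u, u)` with `u` a non-zero vector of the domain. -/
def numRange (A : H →ₗ.[ℂ] H) : Set ℝ :=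
  {a | ∃ u : A.domain, u ≠ 0 ∧
    (a : ℂ) = inner ℂ (u : H) (A u) / inner ℂ (u : H) (u : H)}

/-- The numerical range of an everywhere defined bounded operator. -/
def numRangeBdd (B : H →L[ℂ] H) : Set ℝ :=
  numRange ((B : H →ₗ[ℂ] H).toPMap ⊤)

/-- The set `Ω`, the product of the closure of `W(A)` in the extended real line and of the
closure of `W(B)` in the real line. -/
def Omega (A : H →ₗ.[ℂ] H) (B : H →L[ℂ] H) : Set (EReal × ℝ) :=
  closure ((fun a : ℝ => (a : EReal)) '' numRange A) ×ˢ closure (numRangeBdd B)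

end Operators

/-- `p_{(α,β)}(ω) = (α - ω²)(c - i d ω - ω²) - β ω²`. -/
def p (c d α β : ℝ) (ω : ℂ) : ℂ :=
  ((α : ℂ) - ω ^ 2) * ((c : ℂ) - Complex.I * d * ω - ω ^ 2) - β * ω ^ 2

/-- The set of the roots `r_n(a, β)`, `n = 1, …, 4`, for an extended real number `a`. For real `a`
these are the roots of the polynomial `p_{(a,β)}`; for `a = ±∞` they are the limit values, on the
Riemann sphere, of the roots of `p_{(α,β)}` as the real number `α` tends to `a`. -/
def rootSet (c d : ℝ) (a : EReal) (β : ℝ) : Set Sphere :=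
  {ω | (∃ α : ℝ, a = (α : EReal) ∧ ∃ z : ℂ, ω = (z : Sphere) ∧ p c d α β z = 0) ∨
    ((a = ⊤ ∨ a = ⊥) ∧ ∃ (α : ℕ → ℝ) (z : ℕ → ℂ),
      Tendsto (fun k => (α k : EReal)) atTop (𝓝 a) ∧
      (∀ k, p c d (α k) β (z k) = 0) ∧
      Tendsto (fun k => (z k : Sphere)) atTop (𝓝 ω))}

/-- `W_X(T)`, the union of the sets of roots over all parameters `(α, β)` in `X`. -/
def W (c d : ℝ) (X : Set (EReal × ℝ)) : Set Sphere :=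
  {ω | ∃ x ∈ X, ω ∈ rootSet c d x.1 x.2}

/-- The imaginary axis `iℝ`, a set of finite points of the Riemann sphere. -/
def imagAxis : Set Sphere :=
  {ω | ∃ μ : ℝ, ω = ((μ * Complex.I : ℂ) : Sphere)}

/-- The closure, in the Riemann sphere, of `W_X(T) \ iℝ`. -/
def offAxisClosure (c d : ℝ) (X : Set (EReal × ℝ)) : Set Sphere :=
  closure (W c d X \ imagAxis)

/-- `C` is a connected component of the subset `S` of the Riemann sphere. -/
def IsComponent (S C : Set Sphere) : Prop :=
  ∃ x ∈ S, C = connectedComponentIn S x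

/-- `S` contains finite points with arbitrarily large imaginary part. -/
def HasLargeImagParts (S : Set Sphere) : Prop :=
  ∀ M : ℝ, ∃ z : ℂ, M < z.im ∧ (z : Sphere) ∈ S

/-- `S` contains a curve segment, that is, a simple arc. -/
def ContainsCurveSegment (S : Set Sphere) : Prop :=
  ∃ γ : unitInterval → Sphere, Continuous γ ∧ Function.Injective γ ∧ range γ ⊆ S

/-- Two disjoint sets are neighbors if their boundaries have a curve segment in common. -/
def Neighbors (S₁ S₂ : Set Sphere) : Prop :=
  Disjoint S₁ S₂ ∧ ContainsCurveSegment (frontier S₁ ∩ frontier S₂)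

/-- The union of all components of `S` that are neighbors of `E`. -/
def neighborUnion (S E : Set Sphere) : Set Sphere :=
  ⋃₀ {C | IsComponent S C ∧ Neighbors C E}

/-- The pair `(𝓘, 𝓞)` after `n` rounds of the labelling algorithm on the components of `S`.
It starts with `𝓘` empty and `𝓞 = O₀`. In a round, `𝓘` becomes the union of all components that
are neighbors of `𝓞`, and then `𝓞` becomes the union of all components that are neighbors of
(the new) `𝓘`. -/
def labels (S O₀ : Set Sphere) : ℕ → Set Sphere × Set Sphere
  | 0 => (∅, O₀)
  | n + 1 =>
    (neighborUnion S (labels S O₀ n).2,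
      neighborUnion S (neighborUnion S (labels S O₀ n).2))

/-- The algorithm stops after round `n`, that is, `n` is the first number of rounds after which
`𝓘 ∪ 𝓞` is all of `S`. -/
def StopsAt (S O₀ : Set Sphere) (n : ℕ) : Prop :=
  IsLeast {k : ℕ | (labels S O₀ k).1 ∪ (labels S O₀ k).2 = S} n

end RationalNumRange

/-!
Write `F` and `G` for the closures of `W_Ω(T) \ iℝ` and `W_∂Ω(T) \ iℝ`. Off the imaginary axis a
point `z` determines its parameters: with `r = |z|²`, `y = Im z`, `D = d r + 2 c y` and
`R = |c - i d z - z²|²`, the equation `p_{(α,β)}(z) = 0` forces `α D = r² (d + 2 y)` and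
`β D = -2 y R`, and conversely where `D ≠ 0` (`mul_den_of_p_eq_zero`, `p_eq_zero_iff`). So away from
the at most two zeros of `c - i d z - z²`, membership in `F` or `G` means that the point
`(α(z), β(z))` lies in the rectangle `Ω` or on its boundary (`coe_mem_offAxisClosure_iff`).

The set `F \ G` is open (`isOpen_closure_rect_diff`). Off the axis this is continuity of the
parameters; on the axis, a half ball that avoids `G` is connected and hence entirely inside or
outside, and the reflection `z ↦ -conj z` carries one half ball to the other; at `∞` and at the
off-axis zeros of `c - i d z - z²`, which are the limits of roots as `α → ±∞`, membership in `F`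
implies membership in `G`. So each component of the complement of `G` lies inside or outside `F`.

The set `G` lies on the real algebraic curves `α = aᵢ` and `β = bⱼ`. These are quadratic in `r` for
fixed `y`, and discriminants show that, outside a finite set, `G` has a regular local equation
(`exists_isLocalEquation`), so by the implicit function theorem it separates the inside from the
outside along an arc (`isColoring_rect`). Therefore neighbors lie on different sides. As the sphere
remains connected when a finite set is removed, every component is reached from every other by
passing through such arcs (`IsColoring.iUnion_labels`). The algorithm stops since there are finitely
many components (`finite_components`): apart from finitely many heights `y`, the curves are
transversal to the horizontal lines, so that a component which meets one line meets all lines up to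
the next exceptional height, and on each line there are only finitely many points of `G`. The
labelled sets are then the components inside and outside `F` (`IsColoring.exists_stopsAt`).

Finally, numerical ranges are intervals (`ordConnected_numRange`), so `Ω` is a rectangle, which is
degenerate, hence equal to its boundary, exactly if one of them is a single point.
-/

namespace RationalNumRange

/-! ### The labelling algorithm for a separating set in the sphere -/

instance locallyConnectedSpace_sphere : LocallyConnectedSpace Sphere := by
  have e := onePointEquivSphereOfFinrankEq (ι := Fin 3) (V := ℂ) (by simp)
  have : Fact (Module.finrank ℝ (EuclideanSpace ℝ (Fin 3)) = 2 + 1) := ⟨by simp⟩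
  have : LocallyConnectedSpace (Metric.sphere (0 : EuclideanSpace ℝ (Fin 3)) 1) :=
    ChartedSpace.locallyConnectedSpace (EuclideanSpace ℝ (Fin 2)) _
  exact e.locallyConnectedSpace

section Components

variable {S C C' E A : Set Sphere}

theorem IsComponent.subset (hC : IsComponent S C) : C ⊆ S := by
  obtain ⟨x, -, rfl⟩ := hC
  exact connectedComponentIn_subset S x

theorem IsComponent.isPreconnected (hC : IsComponent S C) : IsPreconnected C := by
  obtain ⟨x, -, rfl⟩ := hC
  exact isPreconnected_connectedComponentIn

theorem IsComponent.nonempty (hC : IsComponent S C) : C.Nonempty := by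
  obtain ⟨x, hx, rfl⟩ := hC
  exact ⟨x, mem_connectedComponentIn hx⟩

theorem IsComponent.isOpen (hS : IsOpen S) (hC : IsComponent S C) : IsOpen C := by
  obtain ⟨x, -, rfl⟩ := hC
  exact hS.connectedComponentIn

theorem IsComponent.superset (hC : IsComponent S C) (hA : IsPreconnected A) (hAS : A ⊆ S)
    (hne : (A ∩ C).Nonempty) : A ⊆ C := by
  obtain ⟨x, hx, rfl⟩ := hC
  obtain ⟨y, hyA, hyC⟩ := hne
  rw [connectedComponentIn_eq hyC]
  exact hA.subset_connectedComponentIn hyA hAS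

theorem IsComponent.eq_of_inter (hC : IsComponent S C) (hC' : IsComponent S C')
    (hne : (C ∩ C').Nonempty) : C = C' :=
  (hC'.superset hC.isPreconnected hC.subset hne).antisymm
    (hC.superset hC'.isPreconnected hC'.subset (by rwa [inter_comm]))

theorem exists_isComponent_of_mem {x : Sphere} (hx : x ∈ S) : ∃ C, IsComponent S C ∧ x ∈ C :=
  ⟨_, ⟨x, hx, rfl⟩, mem_connectedComponentIn hx⟩

/-- `E` is a union of connected components of `S`. -/
def IsComponentUnion (S E : Set Sphere) : Prop :=
  ∀ x ∈ E, ∃ C, IsComponent S C ∧ x ∈ C ∧ C ⊆ E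

theorem IsComponent.isComponentUnion (hC : IsComponent S C) : IsComponentUnion S C :=
  fun _ hx => ⟨C, hC, hx, Subset.rfl⟩

theorem isComponentUnion_neighborUnion : IsComponentUnion S (neighborUnion S E) := by
  rintro x ⟨C, hC, hx⟩
  exact ⟨C, hC.1, hx, fun y hy => ⟨C, hC, hy⟩⟩

theorem IsComponentUnion.subset (hE : IsComponentUnion S E) : E ⊆ S := fun x hx => by
  obtain ⟨C, hC, hxC, -⟩ := hE x hx
  exact hC.subset hxC

theorem IsComponentUnion.isOpen (hS : IsOpen S) (hE : IsComponentUnion S E) : IsOpen E := by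
  rw [isOpen_iff_mem_nhds]
  intro x hx
  obtain ⟨C, hC, hxC, hCE⟩ := hE x hx
  exact mem_of_superset ((hC.isOpen hS).mem_nhds hxC) hCE

theorem IsComponentUnion.superset (hE : IsComponentUnion S E) (hA : IsPreconnected A)
    (hAS : A ⊆ S) (hne : (A ∩ E).Nonempty) : A ⊆ E := by
  obtain ⟨x, hxA, hxE⟩ := hne
  obtain ⟨C, hC, hxC, hCE⟩ := hE x hxE
  exact (hC.superset hA hAS ⟨x, hxA, hxC⟩).trans hCE

theorem IsComponentUnion.mem_of_mem_closure (hS : IsOpen S) (hE : IsComponentUnion S E)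
    {x : Sphere} (hx : x ∈ closure E) (hxS : x ∈ S) : x ∈ E := by
  obtain ⟨C, hC, hxC⟩ := exists_isComponent_of_mem hxS
  obtain ⟨y, hyC, hyE⟩ := mem_closure_iff.1 hx C (hC.isOpen hS) hxC
  exact hE.superset hC.isPreconnected hC.subset ⟨y, hyC, hyE⟩ hxC

theorem IsComponentUnion.union (hE : IsComponentUnion S E) (hA : IsComponentUnion S A) :
    IsComponentUnion S (E ∪ A) := by
  rintro x (hx | hx)
  · obtain ⟨C, h1, h2, h3⟩ := hE x hx
    exact ⟨C, h1, h2, h3.trans subset_union_left⟩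
  · obtain ⟨C, h1, h2, h3⟩ := hA x hx
    exact ⟨C, h1, h2, h3.trans subset_union_right⟩

end Components

/-- `g` has an open neighborhood `U` that `G` cuts into two connected pieces, one inside `P` and
one inside `Q`, such that the part of `G` in `U` contains an arc and adheres to both pieces. -/
def IsTwoSided (G P Q : Set Sphere) (g : Sphere) : Prop :=
  ∃ U U₁ U₂ : Set Sphere, IsOpen U ∧ g ∈ U ∧ IsPreconnected U₁ ∧ IsPreconnected U₂ ∧
    U₁ ⊆ P ∧ U₂ ⊆ Q ∧ U \ G ⊆ U₁ ∪ U₂ ∧ U ∩ G ⊆ closure U₁ ∧ U ∩ G ⊆ closure U₂ ∧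
    ContainsCurveSegment (U ∩ G)

/-- The complement of the closed set `G` is the disjoint union of the open sets `P` and `Q`, and
`G` locally separates `P` from `Q` at all of its points outside the finite set `Z`. -/
structure IsColoring (G P Q Z : Set Sphere) : Prop where
  isClosed : IsClosed G
  isOpen_left : IsOpen P
  isOpen_right : IsOpen Q
  disjoint : Disjoint P Q
  union_eq : P ∪ Q = Gᶜ
  finite : Z.Finite
  isTwoSided : ∀ g ∈ G, g ∉ Z → IsTwoSided G P Q g

theorem isPreconnected_compl_of_finite {Z : Set Sphere} (hZ : Z.Finite) :
    IsPreconnected Zᶜ := by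
  have h1 : IsPreconnected (((↑) : ℂ → Sphere) ⁻¹' Z)ᶜ :=
    ((hZ.preimage OnePoint.coe_injective.injOn).countable.isConnected_compl_of_one_lt_rank
      (by simp [Complex.rank_real_complex])).isPreconnected
  have h2 := h1.image ((↑) : ℂ → Sphere) OnePoint.continuous_coe.continuousOn
  refine h2.subset_closure ?_ ?_
  · rintro _ ⟨z, hz, rfl⟩
    exact hz
  · intro x hx
    have hd : Dense (range ((↑) : ℂ → Sphere) \ Z) :=
      OnePoint.denseRange_coe.sdiff_finite hZ
    refine closure_mono ?_ (hd x)
    rintro _ ⟨⟨z, rfl⟩, hz⟩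
    exact ⟨z, hz, rfl⟩

theorem exists_mem_notMem_of_finite {Z U : Set Sphere} (hZ : Z.Finite) (hU : IsOpen U)
    (hne : U.Nonempty) : ∃ x ∈ U, x ∉ Z := by
  obtain ⟨x, hxU, -, hxZ⟩ := (dense_univ.sdiff_finite hZ).inter_open_nonempty U hU hne
  exact ⟨x, hxU, hxZ⟩

theorem ContainsCurveSegment.exists_notMem {A Z : Set Sphere} (hA : ContainsCurveSegment A)
    (hZ : Z.Finite) : ∃ x ∈ A, x ∉ Z := by
  obtain ⟨γ, -, hinj, hsub⟩ := hA
  have : Infinite unitInterval := (Icc_infinite zero_lt_one).to_subtype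
  obtain ⟨x, hx, hxZ⟩ := (infinite_range_of_injective hinj).exists_notMem_finite hZ
  exact ⟨x, hsub hx, hxZ⟩

theorem ContainsCurveSegment.mono {A A' : Set Sphere} (hA : ContainsCurveSegment A)
    (h : A ⊆ A') : ContainsCurveSegment A' := by
  obtain ⟨γ, h1, h2, h3⟩ := hA
  exact ⟨γ, h1, h2, h3.trans h⟩

namespace IsColoring

variable {G P Q Z C E E' : Set Sphere}

theorem symm (h : IsColoring G P Q Z) : IsColoring G Q P Z where
  isClosed := h.isClosed
  isOpen_left := h.isOpen_right
  isOpen_right := h.isOpen_left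
  disjoint := h.disjoint.symm
  union_eq := by rw [union_comm]; exact h.union_eq
  finite := h.finite
  isTwoSided := by
    intro g hg hgZ
    obtain ⟨U, U₁, U₂, h1, h2, h3, h4, h5, h6, h7, h8, h9, h10⟩ := h.isTwoSided g hg hgZ
    exact ⟨U, U₂, U₁, h1, h2, h4, h3, h6, h5, by rwa [union_comm], h9, h8, h10⟩

theorem left_subset (h : IsColoring G P Q Z) : P ⊆ Gᶜ := by
  rw [← h.union_eq]; exact subset_union_left

theorem right_subset (h : IsColoring G P Q Z) : Q ⊆ Gᶜ := h.symm.left_subset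

theorem isOpen_compl (h : IsColoring G P Q Z) : IsOpen Gᶜ := h.isClosed.isOpen_compl

theorem subset_or_subset (h : IsColoring G P Q Z) (hC : IsComponent Gᶜ C) : C ⊆ P ∨ C ⊆ Q :=
  hC.isPreconnected.subset_or_subset h.isOpen_left h.isOpen_right h.disjoint
    (by rw [h.union_eq]; exact hC.subset)

theorem mem_of_mem_frontier (h : IsColoring G P Q Z) (hE : IsComponentUnion Gᶜ E)
    {x : Sphere} (hx : x ∈ frontier E) : x ∈ G := by
  by_contra hxG
  rw [(hE.isOpen h.isOpen_compl).frontier_eq] at hx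
  exact hx.2 (hE.mem_of_mem_closure h.isOpen_compl hx.1 hxG)

/-- Two components that share a boundary arc lie on different sides: on one side of the arc there
is room for a single component only. -/
theorem subset_left_of_neighbors (h : IsColoring G P Q Z) (hC : IsComponent Gᶜ C)
    (hE : IsComponentUnion Gᶜ E) (hEQ : E ⊆ Q) (hCE : Neighbors C E) :
    C ⊆ P ∧ ∃ g ∈ G, g ∉ Z ∧ g ∈ closure C ∧ g ∈ closure E := by
  obtain ⟨hdisj, harc⟩ := hCE
  obtain ⟨g, ⟨hgC, hgE⟩, hgZ⟩ := harc.exists_notMem h.finite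
  have hgG := h.mem_of_mem_frontier hE hgE
  have hgC' := frontier_subset_closure hgC
  have hgE' := frontier_subset_closure hgE
  refine ⟨?_, g, hgG, hgZ, hgC', hgE'⟩
  refine (h.subset_or_subset hC).resolve_right fun hCQ => ?_
  obtain ⟨U, U₁, U₂, hU, hgU, -, hU₂, hU₁P, hU₂Q, hUG, -, -, -⟩ := h.isTwoSided g hgG hgZ
  have key : ∀ E : Set Sphere, E ⊆ Q → g ∈ closure E → (U₂ ∩ E).Nonempty := by
    intro E hEQ hgE
    obtain ⟨w, hwU, hwE⟩ := mem_closure_iff.1 hgE U hU hgU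
    refine ⟨w, (hUG ⟨hwU, h.right_subset (hEQ hwE)⟩).resolve_left fun hw => ?_, hwE⟩
    exact h.disjoint.le_bot ⟨hU₁P hw, hEQ hwE⟩
  obtain ⟨w, hwU, hwE⟩ := key E hEQ hgE'
  have hsub := hC.superset hU₂ (hU₂Q.trans h.right_subset) (key C hCQ hgC')
  exact hdisj.le_bot ⟨hsub hwU, hwE⟩

/-- A component of colour `P` and a union of components of colour `Q` with a common boundary point
outside the exceptional set are neighbors. -/
theorem subset_neighborUnion (h : IsColoring G P Q Z) (hC : IsComponent Gᶜ C)
    (hCP : C ⊆ P) (hE : IsComponentUnion Gᶜ E) (hEQ : E ⊆ Q) {g : Sphere} (hg : g ∈ G)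
    (hgZ : g ∉ Z) (hgC : g ∈ closure C) (hgE : g ∈ closure E) :
    C ⊆ neighborUnion Gᶜ E := by
  obtain ⟨U, U₁, U₂, hU, hgU, hU₁, hU₂, hU₁P, hU₂Q, hUG, hcl₁, hcl₂, harc⟩ :=
    h.isTwoSided g hg hgZ
  have h1 : U₁ ⊆ C := by
    obtain ⟨w, hwU, hwC⟩ := mem_closure_iff.1 hgC U hU hgU
    refine hC.superset hU₁ (hU₁P.trans h.left_subset)
      ⟨w, (hUG ⟨hwU, hC.subset hwC⟩).resolve_right fun hw => ?_, hwC⟩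
    exact h.disjoint.le_bot ⟨hCP hwC, hU₂Q hw⟩
  have h2 : U₂ ⊆ E := by
    obtain ⟨w, hwU, hwE⟩ := mem_closure_iff.1 hgE U hU hgU
    refine hE.superset hU₂ (hU₂Q.trans h.right_subset)
      ⟨w, (hUG ⟨hwU, hE.subset hwE⟩).resolve_left fun hw => ?_, hwE⟩
    exact h.disjoint.le_bot ⟨hU₁P hw, hEQ hwE⟩
  refine fun x hx => ⟨C, ⟨hC, h.disjoint.mono hCP hEQ, harc.mono ?_⟩, hx⟩
  intro y hy
  rw [(hC.isOpen h.isOpen_compl).frontier_eq, (hE.isOpen h.isOpen_compl).frontier_eq]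
  exact ⟨⟨closure_mono h1 (hcl₁ hy), fun hyC => hC.subset hyC hy.2⟩,
    closure_mono h2 (hcl₂ hy), fun hyE => hE.subset hyE hy.2⟩

theorem neighborUnion_subset (h : IsColoring G P Q Z) (hE : IsComponentUnion Gᶜ E)
    (hEQ : E ⊆ Q) : neighborUnion Gᶜ E ⊆ P := by
  rintro x ⟨C, ⟨hC, hCE⟩, hx⟩
  exact (h.subset_left_of_neighbors hC hE hEQ hCE).1 hx

theorem neighborUnion_mono (h : IsColoring G P Q Z) (hE : IsComponentUnion Gᶜ E)
    (hE' : IsComponentUnion Gᶜ E') (hEQ' : E' ⊆ Q) (hEE' : E ⊆ E') :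
    neighborUnion Gᶜ E ⊆ neighborUnion Gᶜ E' := by
  rintro x ⟨C, ⟨hC, hCE⟩, hx⟩
  obtain ⟨hCP, g, hg, hgZ, hgC, hgE⟩ :=
    h.subset_left_of_neighbors hC hE (hEE'.trans hEQ') hCE
  exact h.subset_neighborUnion hC hCP hE' hEQ' hg hgZ hgC (closure_mono hEE' hgE) hx

/-- If the complement of `G` is not connected, every component has a boundary point at which `G` is
two-sided, since removing a finite set does not disconnect the sphere. -/
theorem exists_mem_closure (h : IsColoring G P Q Z) {C' : Set Sphere} (hC : IsComponent Gᶜ C)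
    (hC' : IsComponent Gᶜ C') (hne : C ≠ C') : ∃ g ∈ G, g ∉ Z ∧ g ∈ closure C := by
  by_contra! hno
  have hCo := hC.isOpen h.isOpen_compl
  have hsub : Zᶜ ⊆ C := by
    refine (isPreconnected_compl_of_finite h.finite).subset_of_closure_inter_subset hCo ?_ ?_
    · obtain ⟨x, hxC, hxZ⟩ := exists_mem_notMem_of_finite h.finite hCo hC.nonempty
      exact ⟨x, hxZ, hxC⟩
    · rintro x ⟨hxC, hxZ⟩
      by_cases hxG : x ∈ G
      · exact absurd hxC (hno x hxG hxZ)
      · exact hC.isComponentUnion.mem_of_mem_closure h.isOpen_compl hxC hxG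
  obtain ⟨x, hxC', hxZ⟩ :=
    exists_mem_notMem_of_finite h.finite (hC'.isOpen h.isOpen_compl) hC'.nonempty
  exact hne (hC.eq_of_inter hC' ⟨x, hsub hxZ, hxC'⟩)

variable {O₀ : Set Sphere}

theorem labels_spec (h : IsColoring G P Q Z) (hO : IsComponent Gᶜ O₀) (hOQ : O₀ ⊆ Q) (n : ℕ) :
    (IsComponentUnion Gᶜ (labels Gᶜ O₀ n).1 ∧ (labels Gᶜ O₀ n).1 ⊆ P) ∧
      IsComponentUnion Gᶜ (labels Gᶜ O₀ n).2 ∧ (labels Gᶜ O₀ n).2 ⊆ Q := by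
  induction n with
  | zero => exact ⟨⟨fun x hx => hx.elim, empty_subset _⟩, hO.isComponentUnion, hOQ⟩
  | succ n ih =>
    have h1 := h.neighborUnion_subset ih.2.1 ih.2.2
    exact ⟨⟨isComponentUnion_neighborUnion, h1⟩, isComponentUnion_neighborUnion,
      h.symm.neighborUnion_subset isComponentUnion_neighborUnion h1⟩

/-- A component next to a two-sided boundary point of a component `C` of the other colour. -/
theorem exists_adjacent (h : IsColoring G P Q Z)
    {g : Sphere} (hg : g ∈ G) (hgZ : g ∉ Z) :
    ∃ C', IsComponent Gᶜ C' ∧ C' ⊆ P ∧ g ∈ closure C' := by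
  obtain ⟨U, U₁, U₂, hU, hgU, hU₁, hU₂, hU₁P, hU₂Q, hUG, hcl₁, hcl₂, harc⟩ :=
    h.isTwoSided g hg hgZ
  obtain ⟨w, -, hw⟩ := mem_closure_iff.1 (hcl₁ ⟨hgU, hg⟩) U hU hgU
  obtain ⟨C', hC', hwC'⟩ := exists_isComponent_of_mem (h.left_subset (hU₁P hw))
  have hsub := hC'.superset hU₁ (hU₁P.trans h.left_subset) ⟨w, hw, hwC'⟩
  refine ⟨C', hC', (h.subset_or_subset hC').resolve_right fun hq => ?_,
    closure_mono hsub (hcl₁ ⟨hgU, hg⟩)⟩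
  exact h.disjoint.le_bot ⟨hU₁P hw, hq hwC'⟩

theorem labels_mono (h : IsColoring G P Q Z) (hO : IsComponent Gᶜ O₀) (hOQ : O₀ ⊆ Q)
    (hne : O₀ ≠ Gᶜ) (n : ℕ) :
    (labels Gᶜ O₀ n).1 ⊆ (labels Gᶜ O₀ (n + 1)).1 ∧
      (labels Gᶜ O₀ n).2 ⊆ (labels Gᶜ O₀ (n + 1)).2 := by
  have hother : ∀ C, IsComponent Gᶜ C → ∃ C', IsComponent Gᶜ C' ∧ C ≠ C' := by
    intro C hC
    by_cases hCO : C = O₀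
    · subst hCO
      obtain ⟨x, hx, hxC⟩ := exists_of_ssubset (hC.subset.ssubset_of_ne hne)
      obtain ⟨C', hC', hxC'⟩ := exists_isComponent_of_mem hx
      exact ⟨C', hC', fun h => hxC (h ▸ hxC')⟩
    · exact ⟨O₀, hO, hCO⟩
  have h2 : ∀ n, (labels Gᶜ O₀ n).2 ⊆ (labels Gᶜ O₀ (n + 1)).2 := by
    intro n x hx
    obtain ⟨-, hE, hEQ⟩ := h.labels_spec hO hOQ n
    obtain ⟨⟨hE₁, hE₁P⟩, -, -⟩ := h.labels_spec hO hOQ (n + 1)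
    obtain ⟨C, hC, hxC, hCE⟩ := hE x hx
    obtain ⟨D, hD, hCD⟩ := hother C hC
    obtain ⟨g, hg, hgZ, hgC⟩ := h.exists_mem_closure hC hD hCD
    obtain ⟨C', hC', hC'P, hgC'⟩ := h.exists_adjacent hg hgZ
    have h3 : C' ⊆ (labels Gᶜ O₀ (n + 1)).1 :=
      h.subset_neighborUnion hC' hC'P hE hEQ hg hgZ hgC' (closure_mono hCE hgC)
    exact h.symm.subset_neighborUnion hC (hCE.trans hEQ) hE₁ hE₁P hg hgZ hgC
      (closure_mono h3 hgC') hxC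
  refine ⟨?_, h2 n⟩
  cases n with
  | zero => exact empty_subset _
  | succ n =>
    exact h.neighborUnion_mono (h.labels_spec hO hOQ n).2.1 (h.labels_spec hO hOQ (n + 1)).2.1
      (h.labels_spec hO hOQ (n + 1)).2.2 (h2 n)

/-- Every component is reached: otherwise the closures of the reached and of the unreached part
would disconnect the complement of the exceptional set. -/
theorem iUnion_labels (h : IsColoring G P Q Z) (hO : IsComponent Gᶜ O₀) (hOQ : O₀ ⊆ Q) :
    ⋃ n, ((labels Gᶜ O₀ n).1 ∪ (labels Gᶜ O₀ n).2) = Gᶜ := by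
  set V : Set Sphere := ⋃ n, ((labels Gᶜ O₀ n).1 ∪ (labels Gᶜ O₀ n).2) with hV
  have hspec := h.labels_spec hO hOQ
  have hVn : ∀ n, (labels Gᶜ O₀ n).1 ∪ (labels Gᶜ O₀ n).2 ⊆ V :=
    fun n => subset_iUnion_of_subset n Subset.rfl
  have hVu : IsComponentUnion Gᶜ V := by
    intro x hx
    obtain ⟨n, hn⟩ := mem_iUnion.1 hx
    obtain ⟨C, h1, h2, h3⟩ := ((hspec n).1.1.union (hspec n).2.1) x hn
    exact ⟨C, h1, h2, h3.trans (hVn n)⟩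
  -- the components outside `V`
  have hWu : IsComponentUnion Gᶜ (Gᶜ \ V) := by
    intro x hx
    obtain ⟨C, hC, hxC⟩ := exists_isComponent_of_mem hx.1
    refine ⟨C, hC, hxC, fun y hy => ⟨hC.subset hy, fun hyV => hx.2 ?_⟩⟩
    exact hVu.superset hC.isPreconnected hC.subset ⟨y, hy, hyV⟩ hxC
  refine hVu.subset.antisymm ?_
  by_contra hnot
  obtain ⟨x₀, hx₀, hx₀V⟩ := not_subset.1 hnot
  have hVo := hVu.isOpen h.isOpen_compl
  have hWo := hWu.isOpen h.isOpen_compl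
  have hOV : O₀ ⊆ V := subset_union_right.trans (hVn 0)
  have hcover : Zᶜ ⊆ closure V ∪ closure (Gᶜ \ V) := by
    intro x hxZ
    by_cases hxG : x ∈ G
    · obtain ⟨U, U₁, U₂, hU, hgU, hU₁, hU₂, hU₁P, hU₂Q, hUG, hcl₁, hcl₂, harc⟩ :=
        h.isTwoSided x hxG hxZ
      have : x ∈ closure (V ∪ Gᶜ \ V) := by
        refine closure_mono ?_ (hcl₁ ⟨hgU, hxG⟩)
        rw [union_sdiff_self]
        exact (hU₁P.trans h.left_subset).trans subset_union_right
      rwa [closure_union] at this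
    · by_cases hxV : x ∈ V
      · exact Or.inl (subset_closure hxV)
      · exact Or.inr (subset_closure ⟨hxG, hxV⟩)
  obtain ⟨y₁, hy₁, hy₁Z⟩ := exists_mem_notMem_of_finite h.finite hVo (hO.nonempty.mono hOV)
  obtain ⟨y₂, hy₂, hy₂Z⟩ := exists_mem_notMem_of_finite h.finite hWo ⟨x₀, hx₀, hx₀V⟩
  obtain ⟨g, hgZ, hgV, hgW⟩ := isPreconnected_closed_iff.1
    (isPreconnected_compl_of_finite h.finite) _ _ isClosed_closure isClosed_closure hcover
    ⟨y₁, hy₁Z, subset_closure hy₁⟩ ⟨y₂, hy₂Z, subset_closure hy₂⟩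
  by_cases hgG : g ∈ G
  swap
  · exact (hWu.mem_of_mem_closure h.isOpen_compl hgW hgG).2
      (hVu.mem_of_mem_closure h.isOpen_compl hgV hgG)
  obtain ⟨U, U₁, U₂, hU, hgU, hU₁, hU₂, hU₁P, hU₂Q, hUG, hcl₁, hcl₂, harc⟩ :=
    h.isTwoSided g hgG hgZ
  obtain ⟨v, hvU, hvV⟩ := mem_closure_iff.1 hgV U hU hgU
  obtain ⟨w, hwU, hwW⟩ := mem_closure_iff.1 hgW U hU hgU
  obtain ⟨C, hC, hvC⟩ := exists_isComponent_of_mem (hVu.subset hvV)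
  obtain ⟨C', hC', hwC'⟩ := exists_isComponent_of_mem hwW.1
  have hC'W : C' ⊆ Gᶜ \ V := hWu.superset hC'.isPreconnected hC'.subset ⟨w, hwC', hwW⟩
  obtain ⟨n, hn⟩ := mem_iUnion.1 hvV
  obtain ⟨⟨hI, hIP⟩, hE, hEQ⟩ := hspec n
  have hvG := hUG ⟨hvU, hVu.subset hvV⟩
  have hwG := hUG ⟨hwU, hwW.1⟩
  -- a piece that meets both parts of the sphere is impossible
  have hnot : ∀ A : Set Sphere, IsPreconnected A → A ⊆ Gᶜ → v ∈ A → w ∈ A → False :=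
    fun A hA hAG hv hw => hwW.2 (hVu.superset hA hAG ⟨v, hv, hvV⟩ hw)
  have hU₁G := hU₁P.trans h.left_subset
  have hU₂G := hU₂Q.trans h.right_subset
  rcases hvG with hv | hv <;> rcases hwG with hw | hw
  · exact hnot U₁ hU₁ hU₁G hv hw
  · have hvI : v ∈ (labels Gᶜ O₀ n).1 :=
      hn.resolve_right fun hq => h.disjoint.le_bot ⟨hU₁P hv, hEQ hq⟩
    have h1 : U₁ ⊆ (labels Gᶜ O₀ n).1 := hI.superset hU₁ hU₁G ⟨v, hv, hvI⟩
    have h2 : U₂ ⊆ C' := hC'.superset hU₂ hU₂G ⟨w, hw, hwC'⟩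
    have hC'Q : C' ⊆ Q := (h.subset_or_subset hC').resolve_left fun hq =>
      h.disjoint.le_bot ⟨hq hwC', hU₂Q hw⟩
    have h3 := h.symm.subset_neighborUnion hC' hC'Q hI hIP hgG hgZ
      (closure_mono h2 (hcl₂ ⟨hgU, hgG⟩)) (closure_mono h1 (hcl₁ ⟨hgU, hgG⟩)) hwC'
    cases n with
    | zero => exact hvI
    | succ n => exact hwW.2 (hVn (n + 1) (Or.inr h3))
  · have hvE : v ∈ (labels Gᶜ O₀ n).2 :=
      hn.resolve_left fun hq => h.disjoint.le_bot ⟨hIP hq, hU₂Q hv⟩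
    have h1 : U₂ ⊆ (labels Gᶜ O₀ n).2 := hE.superset hU₂ hU₂G ⟨v, hv, hvE⟩
    have h2 : U₁ ⊆ C' := hC'.superset hU₁ hU₁G ⟨w, hw, hwC'⟩
    have hC'P : C' ⊆ P := (h.subset_or_subset hC').resolve_right fun hq =>
      h.disjoint.le_bot ⟨hU₁P hw, hq hwC'⟩
    have h3 := h.subset_neighborUnion hC' hC'P hE hEQ hgG hgZ
      (closure_mono h2 (hcl₁ ⟨hgU, hgG⟩)) (closure_mono h1 (hcl₂ ⟨hgU, hgG⟩)) hwC'
    exact hwW.2 (hVn (n + 1) (Or.inl h3))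
  · exact hnot U₂ hU₂ hU₂G hv hw

theorem exists_labels_eq (h : IsColoring G P Q Z) (hfin : {C | IsComponent Gᶜ C}.Finite)
    (hO : IsComponent Gᶜ O₀) (hOQ : O₀ ⊆ Q) :
    ∃ n, (labels Gᶜ O₀ n).1 ∪ (labels Gᶜ O₀ n).2 = Gᶜ := by
  by_cases hne : O₀ = Gᶜ
  · exact ⟨0, by simp [labels, hne]⟩
  have hspec := h.labels_spec hO hOQ
  have hmono : Monotone fun n => (labels Gᶜ O₀ n).1 ∪ (labels Gᶜ O₀ n).2 :=
    monotone_nat_of_le_succ fun n =>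
      union_subset_union (h.labels_mono hO hOQ hne n).1 (h.labels_mono hO hOQ hne n).2
  have hreach : ∀ C ∈ {C | IsComponent Gᶜ C},
      ∃ n, C ⊆ (labels Gᶜ O₀ n).1 ∪ (labels Gᶜ O₀ n).2 := by
    intro C hC
    obtain ⟨x, hx⟩ := hC.nonempty
    have hxV : x ∈ ⋃ n, ((labels Gᶜ O₀ n).1 ∪ (labels Gᶜ O₀ n).2) := by
      rw [h.iUnion_labels hO hOQ]; exact hC.subset hx
    obtain ⟨n, hn⟩ := mem_iUnion.1 hxV
    exact ⟨n, ((hspec n).1.1.union (hspec n).2.1).superset hC.isPreconnected hC.subset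
      ⟨x, hx, hn⟩⟩
  choose! N hN using hreach
  obtain ⟨M, hM⟩ := (hfin.image N).bddAbove
  refine ⟨M, ((hspec M).1.1.union (hspec M).2.1).subset.antisymm fun x hx => ?_⟩
  obtain ⟨C, hC, hxC⟩ := exists_isComponent_of_mem hx
  exact hmono (hM (mem_image_of_mem N hC)) (hN C hC hxC)

/-- The labelling algorithm terminates and labels exactly the set `P`. -/
theorem exists_stopsAt (h : IsColoring G P Q Z) (hfin : {C | IsComponent Gᶜ C}.Finite)
    (hO : IsComponent Gᶜ O₀) (hOQ : O₀ ⊆ Q) :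
    ∃ n, StopsAt Gᶜ O₀ n ∧ (labels Gᶜ O₀ n).1 = P := by
  classical
  have hex := h.exists_labels_eq hfin hO hOQ
  refine ⟨Nat.find hex, ⟨Nat.find_spec hex, fun k hk => Nat.find_min' hex hk⟩, ?_⟩
  obtain ⟨⟨-, hP⟩, -, hQ⟩ := h.labels_spec hO hOQ (Nat.find hex)
  refine hP.antisymm fun x hx => ?_
  have hx' : x ∈ (labels Gᶜ O₀ (Nat.find hex)).1 ∪ (labels Gᶜ O₀ (Nat.find hex)).2 := by
    rw [Nat.find_spec hex]; exact h.left_subset hx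
  exact hx'.resolve_right fun hq => h.disjoint.le_bot ⟨hx, hQ hq⟩

end IsColoring

/-! ### Regular level sets in the plane -/

/-- The regular level set of a real function on the plane: every neighborhood of a regular zero
contains a smaller one that the zero set cuts into two connected pieces. -/
theorem exists_nhds_of_regular {f : ℂ → ℝ} {f' : ℂ →L[ℝ] ℝ} {g : ℂ} (hf : HasStrictFDerivAt f f' g)
    (hf' : f' ≠ 0) (hfg : f g = 0) {N : Set ℂ} (hN : N ∈ 𝓝 g) :
    ∃ U ⊆ N, IsOpen U ∧ g ∈ U ∧ IsPreconnected (U ∩ {z | 0 < f z}) ∧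
      IsPreconnected (U ∩ {z | f z < 0}) ∧
      U ∩ {z | f z = 0} ⊆ closure (U ∩ {z | 0 < f z}) ∧
      U ∩ {z | f z = 0} ⊆ closure (U ∩ {z | f z < 0}) ∧
      ∃ γ : unitInterval → ℂ, Continuous γ ∧ Function.Injective γ ∧
        range γ ⊆ U ∩ {z | f z = 0} := by
  have hrange : f'.range = ⊤ := by
    have : (f' : ℂ →ₗ[ℝ] ℝ) ≠ 0 := fun h => hf' (by ext x; exact LinearMap.congr_fun h x)
    exact LinearMap.range_eq_top.2 (LinearMap.surjective this)
  set e := hf.implicitToOpenPartialHomeomorph f f' hrange with he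
  have hgs : g ∈ e.source := hf.mem_implicitToOpenPartialHomeomorph_source hrange
  have heg : e g = (0, 0) := by
    rw [he, hf.implicitToOpenPartialHomeomorph_self hrange, hfg]
  have hfst : ∀ z, (e z).1 = f z := fun z => hf.implicitToOpenPartialHomeomorph_fst hrange z
  have h0t : ((0 : ℝ), (0 : f'.ker)) ∈ e.target := heg ▸ e.map_source hgs
  have hsymm0 : e.symm (0, 0) = g := by rw [← heg, e.left_inv hgs]
  have hpre : e.target ∩ e.symm ⁻¹' N ∈ 𝓝 ((0 : ℝ), (0 : f'.ker)) := by
    refine inter_mem (e.open_target.mem_nhds h0t) ?_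
    have := (e.continuousAt_symm h0t).preimage_mem_nhds (t := N)
    rw [hsymm0] at this
    exact this hN
  obtain ⟨ε, hε, hball⟩ := Metric.mem_nhds_iff.1 hpre
  rw [← ball_prod_same] at hball
  set B : Set f'.ker := Metric.ball 0 ε with hB
  have hBc : IsPreconnected B := (convex_ball _ _).isPreconnected
  have hmem : ∀ {t : ℝ} {w : f'.ker}, |t| < ε → w ∈ B →
      (t, w) ∈ e.target ∧ e.symm (t, w) ∈ N ∧ f (e.symm (t, w)) = t := by
    intro t w ht hw
    have h1 := hball (show (t, w) ∈ Metric.ball (0 : ℝ) ε ×ˢ B from ⟨by simpa using ht, hw⟩)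
    refine ⟨h1.1, h1.2, ?_⟩
    rw [← hfst, e.right_inv h1.1]
  set U : Set ℂ := e.symm '' (Metric.ball (0 : ℝ) ε ×ˢ B) with hU
  have hUopen : IsOpen U := by
    refine e.symm.isOpen_image_of_subset_source (Metric.isOpen_ball.prod Metric.isOpen_ball) ?_
    exact fun x hx => (hball hx).1
  have hcont : ContinuousOn e.symm (Metric.ball (0 : ℝ) ε ×ˢ B) :=
    e.continuousOn_symm.mono fun x hx => (hball hx).1
  have hconn : ∀ s : Set ℝ, IsPreconnected (Metric.ball (0 : ℝ) ε ∩ s) →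
      IsPreconnected (U ∩ f ⁻¹' s) := by
    intro s hs
    have : U ∩ f ⁻¹' s = e.symm '' ((Metric.ball (0 : ℝ) ε ∩ s) ×ˢ B) := by
      ext z
      constructor
      · rintro ⟨⟨⟨t, w⟩, ⟨ht, hw⟩, rfl⟩, hz⟩
        have h2 := (hmem (by simpa using ht) hw).2.2
        rw [mem_preimage, h2] at hz
        exact ⟨(t, w), ⟨⟨ht, hz⟩, hw⟩, rfl⟩
      · rintro ⟨⟨t, w⟩, ⟨⟨ht, hts⟩, hw⟩, rfl⟩
        have h2 := (hmem (by simpa using ht) hw).2.2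
        exact ⟨⟨(t, w), ⟨ht, hw⟩, rfl⟩, by rw [mem_preimage, h2]; exact hts⟩
    rw [this]
    exact (hs.prod hBc).image _ (hcont.mono (prod_mono inter_subset_left Subset.rfl))
  have hB0 : (0 : f'.ker) ∈ B := Metric.mem_ball_self hε
  -- points of the level set are limits along the first coordinate of the chart
  have hclos : ∀ s : Set ℝ, (0 : ℝ) ∈ closure (Metric.ball (0 : ℝ) ε ∩ s) →
      U ∩ {z | f z = 0} ⊆ closure (U ∩ f ⁻¹' s) := by
    rintro s hs z ⟨⟨⟨t, w⟩, ⟨ht, hw⟩, rfl⟩, hz⟩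
    have h2 := (hmem (by simpa using ht) hw).2.2
    have ht0 : t = 0 := by rw [← h2]; exact hz
    subst ht0
    have hc : ContinuousWithinAt (fun t : ℝ => e.symm (t, w)) (Metric.ball (0 : ℝ) ε ∩ s) 0 := by
      refine ContinuousAt.continuousWithinAt ?_
      exact ContinuousAt.comp (f := fun t : ℝ => (t, w))
        (e.continuousAt_symm (hmem (by simpa using hε) hw).1) (by fun_prop)
    refine hc.mem_closure hs ?_
    rintro t ⟨ht, hts⟩
    have h3 := (hmem (by simpa using ht) hw).2.2
    exact ⟨⟨(t, w), ⟨ht, hw⟩, rfl⟩, by rw [mem_preimage, h3]; exact hts⟩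
  have hpos : Metric.ball (0 : ℝ) ε ∩ Ioi 0 = Ioo 0 ε := by
    ext t; simp only [Real.ball_eq_Ioo, mem_inter_iff, mem_Ioo, mem_Ioi]; constructor
    · rintro ⟨⟨-, h⟩, h'⟩; exact ⟨h', by linarith⟩
    · rintro ⟨h, h'⟩; exact ⟨⟨by linarith, by linarith⟩, h⟩
  have hneg : Metric.ball (0 : ℝ) ε ∩ Iio 0 = Ioo (-ε) 0 := by
    ext t; simp only [Real.ball_eq_Ioo, mem_inter_iff, mem_Ioo, mem_Iio]; constructor
    · rintro ⟨⟨h, -⟩, h'⟩; exact ⟨by linarith, h'⟩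
    · rintro ⟨h, h'⟩; exact ⟨⟨by linarith, by linarith⟩, h'⟩
  refine ⟨U, ?_, hUopen, ⟨(0, 0), ⟨Metric.mem_ball_self hε, hB0⟩, hsymm0⟩,
    hconn (Ioi 0) (by rw [hpos]; exact isPreconnected_Ioo),
    hconn (Iio 0) (by rw [hneg]; exact isPreconnected_Ioo),
    hclos (Ioi 0) (by rw [hpos, closure_Ioo hε.ne]; exact left_mem_Icc.2 hε.le),
    hclos (Iio 0) (by
      rw [hneg, closure_Ioo (by linarith)]; exact right_mem_Icc.2 (by linarith)), ?_⟩
  · rintro z ⟨⟨t, w⟩, ⟨ht, hw⟩, rfl⟩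
    exact (hmem (by simpa using ht) hw).2.1
  · -- the kernel is a line, which the chart maps into the level set
    have hker : ∃ v : f'.ker, v ≠ 0 := by
      by_contra! h
      have hinj : Function.Injective f' := by
        refine (injective_iff_map_eq_zero f').2 fun a ha => ?_
        have := h ⟨a, ha⟩
        exact congrArg Subtype.val this
      have := LinearMap.finrank_le_finrank_of_injective (f := (f' : ℂ →ₗ[ℝ] ℝ)) hinj
      simp at this
    obtain ⟨v, hv⟩ := hker
    have hvn : 0 < ‖v‖ := norm_pos_iff.2 hv
    have hin : ∀ t : unitInterval, ((t : ℝ) * (ε / (2 * ‖v‖))) • v ∈ B := by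
      intro t
      rw [hB, mem_ball_zero_iff, norm_smul, Real.norm_eq_abs,
        abs_of_nonneg (mul_nonneg t.2.1 (by positivity))]
      have h1 : (t : ℝ) * (ε / (2 * ‖v‖)) * ‖v‖ = t * (ε / 2) := by field_simp
      rw [h1]
      nlinarith [t.2.2]
    refine ⟨fun t => e.symm (0, ((t : ℝ) * (ε / (2 * ‖v‖))) • v), ?_, ?_, ?_⟩
    · refine hcont.comp_continuous (by fun_prop) fun t => ⟨Metric.mem_ball_self hε, hin t⟩
    · intro s t hst
      have h0 : |(0 : ℝ)| < ε := by simpa using hε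
      have h1 := e.symm.injOn (hmem h0 (hin s)).1 (hmem h0 (hin t)).1 hst
      have h2 := smul_left_injective ℝ hv (Prod.ext_iff.1 h1).2
      have h3 : ε / (2 * ‖v‖) ≠ 0 := by positivity
      exact Subtype.ext (mul_right_cancel₀ h3 h2)
    · rintro _ ⟨t, rfl⟩
      exact ⟨⟨_, ⟨Metric.mem_ball_self hε, hin t⟩, rfl⟩,
        (hmem (by simpa using hε) (hin t)).2.2⟩

/-! ### The parameters of an off-axis root -/

section

/-- `|z|²`, as a polynomial in the real and the imaginary part. -/
def sqMod (z : ℂ) : ℝ := z.re ^ 2 + z.im ^ 2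

/-- The common denominator of `alphaOf` and `betaOf`. -/
def den (c d : ℝ) (z : ℂ) : ℝ := d * sqMod z + 2 * c * z.im

/-- `|c - i d z - z²|²`, see `res_eq_normSq`. -/
def res (c d : ℝ) (z : ℂ) : ℝ := (c - sqMod z) ^ 2 + (d + 2 * z.im) * den c d z

/-- The real parameter `α` for which an off-axis point is a root of `p_{(α,β)}`; it is meaningful
where `den` does not vanish. -/
noncomputable def alphaOf (c d : ℝ) (z : ℂ) : ℝ := sqMod z ^ 2 * (d + 2 * z.im) / den c d z

/-- The real parameter `β` for which an off-axis point is a root of `p_{(α,β)}`; it is meaningful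
where `den` does not vanish. -/
noncomputable def betaOf (c d : ℝ) (z : ℂ) : ℝ := -2 * z.im * res c d z / den c d z

variable {c d α β : ℝ} {z : ℂ}

theorem sqMod_pos (hz : z.re ≠ 0) : 0 < sqMod z := by
  unfold sqMod; positivity

theorem p_re (c d α β : ℝ) (z : ℂ) : (p c d α β z).re =
    (α - (z.re ^ 2 - z.im ^ 2)) * (c + d * z.im - (z.re ^ 2 - z.im ^ 2)) -
      2 * z.re * z.im * (d * z.re + 2 * z.re * z.im) - β * (z.re ^ 2 - z.im ^ 2) := by
  simp [p, pow_two]; ring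

theorem p_im (c d α β : ℝ) (z : ℂ) : (p c d α β z).im =
    -(α - (z.re ^ 2 - z.im ^ 2)) * (d * z.re + 2 * z.re * z.im) -
      2 * z.re * z.im * (c + d * z.im - (z.re ^ 2 - z.im ^ 2)) - 2 * β * z.re * z.im := by
  simp [p, pow_two]; ring

theorem res_eq_normSq (c d : ℝ) (z : ℂ) :
    res c d z = Complex.normSq ((c : ℂ) - Complex.I * d * z - z ^ 2) := by
  simp [res, den, sqMod, Complex.normSq_apply, pow_two]; ring

theorem res_eq_zero_iff : res c d z = 0 ↔ (c : ℂ) - Complex.I * d * z - z ^ 2 = 0 := by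
  rw [res_eq_normSq, Complex.normSq_eq_zero]

theorem mul_den_of_p_eq_zero (hz : z.re ≠ 0) (h : p c d α β z = 0) :
    α * den c d z = sqMod z ^ 2 * (d + 2 * z.im) ∧ β * den c d z = -2 * z.im * res c d z := by
  have h1 : (p c d α β z).re = 0 := by rw [h]; rfl
  have h2 : (p c d α β z).im = 0 := by rw [h]; rfl
  rw [p_re] at h1
  rw [p_im] at h2
  constructor <;> refine mul_left_cancel₀ hz ?_ <;> simp only [res, den, sqMod]
  · linear_combination (2 * z.re * z.im) * h1 - (z.re ^ 2 - z.im ^ 2) * h2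
  · linear_combination -(d * z.re + 2 * z.re * z.im) * h1 -
      (c + d * z.im - (z.re ^ 2 - z.im ^ 2)) * h2

theorem p_eq_zero_of_den_ne_zero (hz : z.re ≠ 0) (hD : den c d z ≠ 0) :
    p c d (alphaOf c d z) (betaOf c d z) z = 0 := by
  have hα : alphaOf c d z * den c d z = sqMod z ^ 2 * (d + 2 * z.im) := by
    unfold alphaOf; field_simp
  have hβ : betaOf c d z * den c d z = -2 * z.im * res c d z := by
    unfold betaOf; field_simp
  have hm : z.re * den c d z ≠ 0 := mul_ne_zero hz hD
  generalize alphaOf c d z = α at *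
  generalize betaOf c d z = β at *
  simp only [res] at hβ
  apply Complex.ext
  · rw [p_re, Complex.zero_re]
    refine mul_left_cancel₀ hm ?_
    rw [mul_zero]
    simp only [den, sqMod] at *
    linear_combination (z.re * (c + d * z.im - (z.re ^ 2 - z.im ^ 2))) * hα -
      (z.re * (z.re ^ 2 - z.im ^ 2)) * hβ
  · rw [p_im, Complex.zero_im]
    refine mul_left_cancel₀ hm ?_
    rw [mul_zero]
    simp only [den, sqMod] at *
    linear_combination (z.re * -(d * z.re + 2 * z.re * z.im)) * hα -
      (z.re * 2 * z.re * z.im) * hβ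

/-- A zero of the denominator off the imaginary axis can be a root of some `p_{(α,β)}` only if
`c - i d z - z²` vanishes there. -/
theorem den_ne_zero (hd : 0 < d) (hz : z.re ≠ 0) (hR : res c d z ≠ 0)
    (hβ : z.im * res c d z = 0 ∨ p c d α β z = 0) : den c d z ≠ 0 := by
  intro hD
  have h0 : z.im = 0 := by
    rcases hβ with h | h
    · exact (mul_eq_zero.1 h).resolve_right hR
    · have := (mul_den_of_p_eq_zero hz h).2
      rw [hD, mul_zero] at this
      rcases mul_eq_zero.1 this.symm with h | h
      · linarith
      · exact absurd h hR
  have : 0 < d * sqMod z := mul_pos hd (sqMod_pos hz)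
  simp only [den, h0] at hD
  linarith

theorem p_eq_zero_iff (hd : 0 < d) (hz : z.re ≠ 0) (hR : res c d z ≠ 0) :
    p c d α β z = 0 ↔ den c d z ≠ 0 ∧ α = alphaOf c d z ∧ β = betaOf c d z := by
  constructor
  · intro h
    have hD := den_ne_zero hd hz hR (Or.inr h)
    obtain ⟨h1, h2⟩ := mul_den_of_p_eq_zero hz h
    exact ⟨hD, by rw [alphaOf, ← h1]; field_simp, by rw [betaOf, ← h2]; field_simp⟩
  · rintro ⟨hD, rfl, rfl⟩
    exact p_eq_zero_of_den_ne_zero hz hD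

theorem p_neg_conj (c d α β : ℝ) (z : ℂ) :
    p c d α β (-(starRingEnd ℂ) z) = (starRingEnd ℂ) (p c d α β z) := by
  apply Complex.ext
  · rw [p_re, Complex.conj_re, p_re]; simp; ring
  · rw [p_im, Complex.conj_im, p_im]; simp; ring

/-- Four roots of the monic quartic `p_{(α,β)}`. -/
theorem exists_roots (c d α β : ℝ) : ∃ s : Multiset ℂ, s.card = 4 ∧
    ∀ w, p c d α β w = (s.map fun r => w - r).prod := by
  open Polynomial in
  set q : ℂ[X] := X ^ 4 + (C (Complex.I * d) * X ^ 3 + C (-(α + c + β) : ℂ) * X ^ 2 +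
    C (-(α * Complex.I * d)) * X + C (α * c : ℂ)) with hq
  have hdeg : q.natDegree = 4 := by rw [hq]; compute_degree!
  have hmon : q.Monic := by rw [hq]; monicity!
  have hsp := IsAlgClosed.splits q
  refine ⟨q.roots, by rw [← hdeg]; exact hsp.natDegree_eq_card_roots.symm, fun w => ?_⟩
  have h1 : q.eval w = p c d α β w := by
    simp [hq, p]; ring
  rw [← h1]
  conv_lhs => rw [hsp.eq_prod_roots_of_monic hmon]
  rw [Polynomial.eval_multiset_prod, Multiset.map_map]
  simp

theorem p_eq_zero_of_mem_roots {s : Multiset ℂ}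
    (h : ∀ w, p c d α β w = (s.map fun r => w - r).prod) {r : ℂ} (hr : r ∈ s) :
    p c d α β r = 0 := by
  rw [h, Multiset.prod_eq_zero_iff, Multiset.mem_map]
  exact ⟨r, hr, sub_self r⟩

end

/-! ### Roots on the Riemann sphere and their closure -/

section

variable {c d α β : ℝ} {z : ℂ} {a : EReal} {X : Set (EReal × ℝ)}

theorem coe_mem_rootSet_coe : (z : Sphere) ∈ rootSet c d (α : EReal) β ↔ p c d α β z = 0 := by
  constructor
  · rintro (⟨α', hα, z', hz, h⟩ | ⟨h | h, -⟩)
    · rw [EReal.coe_eq_coe_iff] at hα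
      rw [OnePoint.coe_eq_coe] at hz
      rw [hα, hz]
      exact h
    · exact absurd h (EReal.coe_ne_top α)
    · exact absurd h (EReal.coe_ne_bot α)
  · exact fun h => Or.inl ⟨α, rfl, z, rfl, h⟩

theorem tendsto_inv_zero_of_tendsto_coe {u : ℕ → ℝ} (ha : a = ⊤ ∨ a = ⊥)
    (hu : Tendsto (fun k => (u k : EReal)) atTop (𝓝 a)) :
    (∀ᶠ k in atTop, u k ≠ 0) ∧ Tendsto (fun k => (u k)⁻¹) atTop (𝓝 0) := by
  rcases ha with rfl | rfl
  · rw [EReal.tendsto_coe_nhds_top_iff] at hu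
    exact ⟨hu.eventually_ne_atTop 0, tendsto_inv_atTop_zero.comp hu⟩
  · rw [EReal.tendsto_coe_nhds_bot_iff] at hu
    exact ⟨hu.eventually_ne_atBot 0, tendsto_inv_atBot_zero.comp hu⟩

/-- The finite limits of roots, as `α → ±∞`, are the zeros of `c - i d z - z²`. -/
theorem res_eq_zero_of_mem_rootSet (ha : a = ⊤ ∨ a = ⊥) (h : (z : Sphere) ∈ rootSet c d a β) :
    res c d z = 0 := by
  rcases h with ⟨α, rfl, -⟩ | ⟨-, u, w, hu, hp, hw⟩
  · rcases ha with h | h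
    · exact absurd h (EReal.coe_ne_top α)
    · exact absurd h (EReal.coe_ne_bot α)
  obtain ⟨hne, hinv⟩ := tendsto_inv_zero_of_tendsto_coe ha hu
  have hw' : Tendsto w atTop (𝓝 z) :=
    (OnePoint.isOpenEmbedding_coe.isInducing.tendsto_nhds_iff).2 hw
  rw [res_eq_zero_iff]
  have hinv' : Tendsto (fun k => (((u k)⁻¹ : ℝ) : ℂ)) atTop (𝓝 0) := by
    exact (Complex.continuous_ofReal.tendsto' 0 0 Complex.ofReal_zero).comp hinv
  have hcont : Continuous fun w : ℂ =>
      w ^ 2 * ((c : ℂ) - Complex.I * d * w - w ^ 2) + β * w ^ 2 := by fun_prop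
  have h1 := hinv'.mul ((hcont.tendsto z).comp hw')
  rw [zero_mul] at h1
  have hcont' : Continuous fun w : ℂ => (c : ℂ) - Complex.I * d * w - w ^ 2 := by fun_prop
  refine tendsto_nhds_unique ((hcont'.tendsto z).comp hw') (h1.congr' ?_)
  filter_upwards [hne] with k hk
  have h2 := hp k
  have hk' : (u k : ℂ) ≠ 0 := by exact_mod_cast hk
  simp only [p] at h2
  simp only [Function.comp_apply, Complex.ofReal_inv]
  rw [inv_mul_eq_div, div_eq_iff hk']
  linear_combination -h2

theorem norm_prod_map_le {ι : Type*} {f g : ι → ℂ} {K : ℝ} (hK : 0 ≤ K) (s : Multiset ι)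
    (h : ∀ r ∈ s, ‖f r‖ ≤ K * ‖g r‖) :
    ‖(s.map f).prod‖ ≤ K ^ s.card * ‖(s.map g).prod‖ := by
  induction s using Multiset.induction_on with
  | empty => simp
  | cons r s ih =>
    have h1 := h r (Multiset.mem_cons_self r s)
    have h2 := ih fun r' hr' => h r' (Multiset.mem_cons_of_mem hr')
    simp only [Multiset.map_cons, Multiset.prod_cons, norm_mul, Multiset.card_cons]
    calc ‖f r‖ * ‖(s.map f).prod‖ ≤ (K * ‖g r‖) * (K ^ s.card * ‖(s.map g).prod‖) := by gcongr
      _ = _ := by ring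

theorem lt_norm_p_one (hd : 0 < d) {K : ℝ} (hα : K / d + 1 < |α|) : K < ‖p c d α β 1‖ := by
  have h1 : (p c d α β 1).im = -(d * (α - 1)) := by rw [p_im]; simp; ring
  have h2 : |α| - 1 ≤ |α - 1| := by
    have := abs_sub_abs_le_abs_sub α 1
    simpa using this
  have h3 := Complex.abs_im_le_norm (p c d α β 1)
  rw [h1, abs_neg, abs_mul, abs_of_pos hd] at h3
  have h4 : K < d * (|α| - 1) := by
    rw [div_add_one hd.ne', div_lt_iff₀ hd] at hα
    linarith
  exact (h4.trans_le (by gcongr)).trans_le h3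

/-- As `|α| → ∞`, some root tends to infinity. -/
theorem exists_root_norm_gt (hd : 0 < d) (K : ℝ) (hα : (1 + |K|) ^ 4 / d + 1 < |α|) :
    ∃ w, p c d α β w = 0 ∧ K < ‖w‖ := by
  obtain ⟨s, hs, hp⟩ := exists_roots c d α β
  by_contra! hno
  have h1 : ‖(s.map fun r => 1 - r).prod‖ ≤
      (1 + |K|) ^ s.card * ‖(s.map fun _ => (1 : ℂ)).prod‖ := by
    refine norm_prod_map_le (by positivity) s fun r hr => ?_
    have h2 := hno r (p_eq_zero_of_mem_roots hp hr)
    have h3 := norm_sub_le (1 : ℂ) r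
    rw [norm_one] at h3 ⊢
    linarith [le_abs_self K]
  rw [← hp, hs] at h1
  have h4 := lt_norm_p_one (c := c) (β := β) hd hα
  simp at h1
  linarith

/-- As `|α| → ∞`, some root tends to a given zero of `c - i d z - z²`: the value of the quartic at
that zero stays bounded, while its values at other points do not. -/
theorem exists_root_norm_sub_lt (hd : 0 < d) (hR : res c d z = 0) (β : ℝ) {ε : ℝ} (hε : 0 < ε)
    (hα : (1 + ‖1 - z‖ / ε) ^ 4 * ‖(β : ℂ) * z ^ 2‖ / d + 1 < |α|) :
    ∃ w, p c d α β w = 0 ∧ ‖w - z‖ < ε := by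
  obtain ⟨s, hs, hp⟩ := exists_roots c d α β
  by_contra! hno
  have h1 : ‖(s.map fun r => 1 - r).prod‖ ≤
      (1 + ‖1 - z‖ / ε) ^ s.card * ‖(s.map fun r => z - r).prod‖ := by
    refine norm_prod_map_le (by positivity) s fun r hr => ?_
    have h2 := hno r (p_eq_zero_of_mem_roots hp hr)
    rw [norm_sub_rev] at h2
    have h3 := norm_add_le (1 - z) (z - r)
    rw [sub_add_sub_cancel] at h3
    have h4 : ‖1 - z‖ ≤ ‖1 - z‖ / ε * ‖z - r‖ := by
      rw [div_mul_eq_mul_div, le_div_iff₀ hε]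
      gcongr
    linarith
  rw [← hp, ← hp, hs] at h1
  have h5 : p c d α β z = -((β : ℂ) * z ^ 2) := by
    rw [res_eq_zero_iff] at hR
    rw [p, hR]; ring
  rw [h5, norm_neg] at h1
  exact absurd (lt_norm_p_one (c := c) (β := β) hd hα) (not_lt.2 h1)

/-- Real sequences that tend to `±∞` with absolute values above a prescribed sequence. -/
theorem exists_coe_seq (ha : a = ⊤ ∨ a = ⊥) (m : ℕ → ℝ) :
    ∃ u : ℕ → ℝ, (∀ k, m k < |u k|) ∧ Tendsto (fun k => (u k : EReal)) atTop (𝓝 a) := by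
  have h1 : ∀ k : ℕ, m k < |(|m k| + k + 1)| := fun k => by
    rw [abs_of_nonneg (by positivity)]
    have := le_abs_self (m k)
    have : (0 : ℝ) ≤ k := by positivity
    linarith
  have h2 : Tendsto (fun k : ℕ => |m k| + k + 1) atTop atTop := by
    refine tendsto_atTop_mono (fun k => ?_) tendsto_natCast_atTop_atTop
    have := abs_nonneg (m k)
    linarith
  rcases ha with rfl | rfl
  · exact ⟨_, h1, EReal.tendsto_coe_nhds_top_iff.2 h2⟩
  · refine ⟨fun k => -(|m k| + k + 1), fun k => ?_, EReal.tendsto_coe_nhds_bot_iff.2 ?_⟩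
    · rw [abs_neg]; exact h1 k
    · exact tendsto_neg_atTop_atBot.comp h2

theorem infty_mem_rootSet (hd : 0 < d) (ha : a = ⊤ ∨ a = ⊥) :
    OnePoint.infty ∈ rootSet c d a β := by
  obtain ⟨u, hu, hua⟩ := exists_coe_seq ha fun k : ℕ => (1 + |(k : ℝ)|) ^ 4 / d + 1
  choose w hw hwk using fun k : ℕ => exists_root_norm_gt (c := c) (β := β) hd (k : ℝ) (hu k)
  refine Or.inr ⟨ha, u, w, hua, hw, ?_⟩
  have h1 : Tendsto w atTop (coclosedCompact ℂ) := by
    rw [coclosedCompact_eq_cocompact, ← Metric.cobounded_eq_cocompact,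
      ← tendsto_norm_atTop_iff_cobounded]
    exact tendsto_atTop_mono (fun k => (hwk k).le) tendsto_natCast_atTop_atTop
  exact OnePoint.tendsto_coe_infty.comp h1

theorem coe_mem_rootSet_of_res_eq_zero (hd : 0 < d) (ha : a = ⊤ ∨ a = ⊥) (hR : res c d z = 0) :
    (z : Sphere) ∈ rootSet c d a β := by
  obtain ⟨u, hu, hua⟩ := exists_coe_seq ha fun k : ℕ =>
    (1 + ‖1 - z‖ / (1 / ((k : ℝ) + 1))) ^ 4 * ‖(β : ℂ) * z ^ 2‖ / d + 1
  choose w hw hwk using fun k : ℕ => exists_root_norm_sub_lt (c := c) hd hR β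
    (by positivity : 0 < 1 / ((k : ℝ) + 1)) (hu k)
  refine Or.inr ⟨ha, u, w, hua, hw, (OnePoint.continuous_coe.tendsto z).comp ?_⟩
  rw [tendsto_iff_norm_sub_tendsto_zero]
  exact squeeze_zero (fun k => norm_nonneg _) (fun k => (hwk k).le)
    tendsto_one_div_add_atTop_nhds_zero_nat

theorem coe_mem_imagAxis : (z : Sphere) ∈ imagAxis ↔ z.re = 0 := by
  constructor
  · rintro ⟨μ, h⟩
    rw [OnePoint.coe_eq_coe] at h
    simp [h]
  · intro h
    exact ⟨z.im, by rw [OnePoint.coe_eq_coe]; apply Complex.ext <;> simp [h]⟩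

theorem infty_notMem_imagAxis : OnePoint.infty ∉ imagAxis := by
  rintro ⟨μ, h⟩
  exact OnePoint.infty_ne_coe _ h

theorem coe_mem_W_iff (hd : 0 < d) (hz : z.re ≠ 0) (hR : res c d z ≠ 0) :
    (z : Sphere) ∈ W c d X ↔ den c d z ≠ 0 ∧ ((alphaOf c d z : EReal), betaOf c d z) ∈ X := by
  constructor
  · rintro ⟨⟨a, β⟩, hx, h⟩
    induction a using EReal.rec with
    | bot => exact absurd (res_eq_zero_of_mem_rootSet (Or.inr rfl) h) hR
    | top => exact absurd (res_eq_zero_of_mem_rootSet (Or.inl rfl) h) hR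
    | coe α =>
      obtain ⟨h1, rfl, rfl⟩ := (p_eq_zero_iff hd hz hR).1 (coe_mem_rootSet_coe.1 h)
      exact ⟨h1, hx⟩
  · rintro ⟨hD, hx⟩
    exact ⟨_, hx, coe_mem_rootSet_coe.2 (p_eq_zero_of_den_ne_zero hz hD)⟩

theorem isClosed_offAxisClosure : IsClosed (offAxisClosure c d X) := isClosed_closure

theorem offAxisClosure_mono {X' : Set (EReal × ℝ)} (h : X ⊆ X') :
    offAxisClosure c d X ⊆ offAxisClosure c d X' := by
  refine closure_mono ?_
  rintro ω ⟨⟨x, hx, hω⟩, h2⟩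
  exact ⟨⟨x, h hx, hω⟩, h2⟩

theorem frequently_of_mem_offAxisClosure (h : (z : Sphere) ∈ offAxisClosure c d X) :
    ∃ᶠ w : ℂ in 𝓝 z, w.re ≠ 0 ∧ (w : Sphere) ∈ W c d X := by
  rw [offAxisClosure, mem_closure_iff_frequently, OnePoint.nhds_coe_eq, frequently_map] at h
  exact h.mono fun w hw => ⟨fun h0 => hw.2 (coe_mem_imagAxis.2 h0), hw.1⟩

theorem mem_of_mem_offAxisClosure {T : Set ℂ} (hT : IsClosed T)
    (hsub : ∀ w : ℂ, w.re ≠ 0 → (w : Sphere) ∈ W c d X → w ∈ T)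
    (h : (z : Sphere) ∈ offAxisClosure c d X) : z ∈ T := by
  rw [← hT.closure_eq, mem_closure_iff_frequently]
  exact (frequently_of_mem_offAxisClosure h).mono fun w hw => hsub w hw.1 hw.2

theorem continuous_sqMod : Continuous sqMod := by unfold sqMod; fun_prop

theorem continuous_den : Continuous (den c d) := by
  unfold den; have := continuous_sqMod; fun_prop

theorem continuous_res : Continuous (res c d) := by
  unfold res; have := continuous_sqMod; have := continuous_den (c := c) (d := d); fun_prop

theorem continuousAt_params (hD : den c d z ≠ 0) :
    ContinuousAt (fun w => ((alphaOf c d w : EReal), betaOf c d w)) z := by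
  have h1 : ContinuousAt (alphaOf c d) z := by
    unfold alphaOf
    refine ContinuousAt.div₀ ?_ continuous_den.continuousAt hD
    have := continuous_sqMod
    fun_prop
  have h2 : ContinuousAt (betaOf c d) z := by
    unfold betaOf
    refine ContinuousAt.div₀ ?_ continuous_den.continuousAt hD
    have := continuous_res (c := c) (d := d)
    fun_prop
  exact (continuous_coe_real_ereal.continuousAt.comp h1).prodMk h2

/-- Away from the imaginary axis and from the zeros of `c - i d z - z²`, the closure adds nothing:
near a zero of the common denominator, `β` would be unbounded. -/
theorem coe_mem_offAxisClosure_iff (hd : 0 < d) (hX : IsClosed X) {K : ℝ}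
    (hK : ∀ x ∈ X, |x.2| ≤ K) (hz : z.re ≠ 0) (hR : res c d z ≠ 0) :
    (z : Sphere) ∈ offAxisClosure c d X ↔
      den c d z ≠ 0 ∧ ((alphaOf c d z : EReal), betaOf c d z) ∈ X := by
  constructor
  · intro h
    have hev : ∃ᶠ w : ℂ in 𝓝 z, den c d w ≠ 0 ∧ ((alphaOf c d w : EReal), betaOf c d w) ∈ X := by
      have h1 : ∀ᶠ w in 𝓝 z, res c d w ≠ 0 := continuous_res.continuousAt.eventually_ne hR
      refine ((frequently_of_mem_offAxisClosure h).and_eventually h1).mono ?_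
      rintro w ⟨⟨hw, hwW⟩, hwR⟩
      exact (coe_mem_W_iff hd hw hwR).1 hwW
    have hD : den c d z ≠ 0 := by
      have hcl : IsClosed {w : ℂ | |2 * w.im * res c d w| ≤ K * |den c d w|} := by
        have := continuous_res (c := c) (d := d)
        have := continuous_den (c := c) (d := d)
        exact isClosed_le (by fun_prop) (by fun_prop)
      have hmem : z ∈ {w : ℂ | |2 * w.im * res c d w| ≤ K * |den c d w|} := by
        rw [← hcl.closure_eq, mem_closure_iff_frequently]
        refine hev.mono ?_
        rintro w ⟨hwD, hwX⟩
        have h2 : 2 * w.im * res c d w = -(betaOf c d w * den c d w) := by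
          unfold betaOf; field_simp
        show |2 * w.im * res c d w| ≤ K * |den c d w|
        rw [h2, abs_neg, abs_mul]
        have := hK _ hwX
        gcongr
      intro h0
      have h3 : |2 * z.im * res c d z| ≤ K * |den c d z| := hmem
      rw [h0, abs_zero, mul_zero, abs_nonpos_iff] at h3
      exact den_ne_zero (α := 0) (β := 0) hd hz hR (Or.inl (by linarith)) h0
    refine ⟨hD, ?_⟩
    by_contra hnot
    have h4 := (continuousAt_params hD).eventually (hX.isOpen_compl.mem_nhds hnot)
    obtain ⟨w, hw1, hw2⟩ := (hev.and_eventually h4).exists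
    exact hw2 hw1.2
  · intro h
    refine subset_closure ⟨(coe_mem_W_iff hd hz hR).2 h, ?_⟩
    rwa [coe_mem_imagAxis]

theorem infty_mem_offAxisClosure (hd : 0 < d) (ha : a = ⊤ ∨ a = ⊥) (h : (a, β) ∈ X) :
    OnePoint.infty ∈ offAxisClosure c d X :=
  subset_closure ⟨⟨_, h, infty_mem_rootSet hd ha⟩, infty_notMem_imagAxis⟩

theorem coe_mem_offAxisClosure_of_res_eq_zero (hd : 0 < d) (ha : a = ⊤ ∨ a = ⊥)
    (h : (a, β) ∈ X) (hz : z.re ≠ 0) (hR : res c d z = 0) :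
    (z : Sphere) ∈ offAxisClosure c d X :=
  subset_closure ⟨⟨_, h, coe_mem_rootSet_of_res_eq_zero hd ha hR⟩, by rwa [coe_mem_imagAxis]⟩

theorem norm_le_of_p_eq_zero (hc : 0 ≤ c) (hd : 0 < d) {K : ℝ} (hα : |α| ≤ K) (hβ : |β| ≤ K)
    (h : p c d α β z = 0) : ‖z‖ ≤ K + d + c + 1 := by
  by_contra! hlt
  set t := ‖z‖ with ht
  have hK : 0 ≤ K := (abs_nonneg α).trans hα
  have h1 : t ^ 2 - K ≤ ‖(α : ℂ) - z ^ 2‖ := by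
    have h2 := norm_sub_norm_le (z ^ 2) (α : ℂ)
    rw [norm_sub_rev, norm_pow, Complex.norm_real, Real.norm_eq_abs] at h2
    linarith
  have h3 : t ^ 2 - d * t - c ≤ ‖(c : ℂ) - Complex.I * d * z - z ^ 2‖ := by
    have h4 : z ^ 2 = ((c : ℂ) - Complex.I * d * z) - ((c : ℂ) - Complex.I * d * z - z ^ 2) := by
      ring
    have h5 := norm_sub_le ((c : ℂ) - Complex.I * d * z)
      ((c : ℂ) - Complex.I * d * z - z ^ 2)
    have h6 := norm_sub_le (c : ℂ) (Complex.I * d * z)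
    rw [← h4, norm_pow] at h5
    rw [norm_mul, norm_mul, Complex.norm_I, one_mul, Complex.norm_real, Complex.norm_real,
      Real.norm_of_nonneg hc, Real.norm_of_nonneg hd.le] at h6
    linarith
  have h7 : ‖(α : ℂ) - z ^ 2‖ * ‖(c : ℂ) - Complex.I * d * z - z ^ 2‖ = |β| * t ^ 2 := by
    rw [← norm_mul, show ((α : ℂ) - z ^ 2) * ((c : ℂ) - Complex.I * d * z - z ^ 2) =
      β * z ^ 2 by rw [p] at h; linear_combination h, norm_mul, norm_pow, Complex.norm_real,
      Real.norm_eq_abs]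
  have ht1 : 1 ≤ t := by linarith
  have h8 : t ≤ t ^ 2 - K := by nlinarith
  have h9 : (K + 1) * t ≤ t ^ 2 - d * t - c := by nlinarith
  have h10 : t * ((K + 1) * t) ≤ |β| * t ^ 2 := by
    rw [← h7]
    exact mul_le_mul (h8.trans h1) (h9.trans h3) (by positivity) (norm_nonneg _)
  have h11 : |β| * t ^ 2 ≤ K * t ^ 2 := by gcongr
  nlinarith

/-- All roots stay in a compact set if the parameters do. -/
theorem infty_notMem_offAxisClosure (hc : 0 ≤ c) (hd : 0 < d) {K : ℝ}
    (hX : ∀ x ∈ X, ∃ α : ℝ, x.1 = α ∧ |α| ≤ K ∧ |x.2| ≤ K) :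
    OnePoint.infty ∉ offAxisClosure c d X := by
  have hsub : W c d X \ imagAxis ⊆ ((↑) : ℂ → Sphere) '' Metric.closedBall 0 (K + d + c + 1) := by
    rintro ω ⟨⟨⟨a, β⟩, hx, hω⟩, -⟩
    obtain ⟨α, rfl : a = α, hα, hβ⟩ := hX _ hx
    rcases hω with ⟨α', hα', z, rfl, hz⟩ | ⟨h | h, -⟩
    · rw [EReal.coe_eq_coe_iff] at hα'
      subst hα'
      exact ⟨z, by simpa using norm_le_of_p_eq_zero hc hd hα hβ hz, rfl⟩
    · exact absurd h (EReal.coe_ne_top α)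
    · exact absurd h (EReal.coe_ne_bot α)
  intro h
  have hcl : IsClosed (((↑) : ℂ → Sphere) '' Metric.closedBall 0 (K + d + c + 1)) :=
    ((isCompact_closedBall _ _).image OnePoint.continuous_coe).isClosed
  obtain ⟨z, -, hz⟩ := closure_minimal hsub hcl h
  exact OnePoint.coe_ne_infty z hz

/-- At a zero of `c - i d z - z²`, only `β = 0` is compatible with bounded `α`. -/
theorem exists_abs_lt_of_res_eq_zero {K m : ℝ} (hm : 0 < m) (hz : z.re ≠ 0)
    (hX : ∀ x ∈ X, ∃ α : ℝ, x.1 = α ∧ |α| ≤ K) (hR : res c d z = 0)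
    (h : (z : Sphere) ∈ offAxisClosure c d X) : ∃ x ∈ X, |x.2| < m := by
  by_contra! hno
  have hcl : IsClosed {w : ℂ | m * ‖w‖ ^ 2 ≤
      (K + ‖w‖ ^ 2) * ‖(c : ℂ) - Complex.I * d * w - w ^ 2‖} :=
    isClosed_le (by fun_prop) (by fun_prop)
  have := mem_of_mem_offAxisClosure hcl ?_ h
  · rw [res_eq_zero_iff] at hR
    rw [mem_ofPred_eq, hR, norm_zero, mul_zero] at this
    have h0 : z ≠ 0 := fun h0 => hz (by rw [h0]; rfl)
    have : 0 < m * ‖z‖ ^ 2 := by positivity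
    linarith
  · rintro w hw ⟨⟨a, β⟩, hx, hω⟩
    obtain ⟨α, rfl : a = α, hα⟩ := hX _ hx
    have hp := coe_mem_rootSet_coe.1 hω
    have h1 : (β : ℂ) * w ^ 2 = (α - w ^ 2) * ((c : ℂ) - Complex.I * d * w - w ^ 2) := by
      rw [p] at hp; linear_combination -hp
    have h2 := congrArg norm h1
    rw [norm_mul, norm_mul, norm_pow, Complex.norm_real, Real.norm_eq_abs] at h2
    have h3 : ‖(α : ℂ) - w ^ 2‖ ≤ K + ‖w‖ ^ 2 := by
      refine (norm_sub_le _ _).trans ?_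
      rw [norm_pow, Complex.norm_real, Real.norm_eq_abs]
      linarith
    have h4 : m ≤ |β| := hno _ hx
    calc m * ‖w‖ ^ 2 ≤ |β| * ‖w‖ ^ 2 := by gcongr
      _ ≤ _ := by rw [h2]; gcongr

theorem neg_conj_mem_W (h : (z : Sphere) ∈ W c d X) :
    ((-(starRingEnd ℂ) z : ℂ) : Sphere) ∈ W c d X := by
  obtain ⟨x, hx, hω⟩ := h
  refine ⟨x, hx, ?_⟩
  rcases hω with ⟨α, hα, z', hz, h⟩ | ⟨ha, u, w, hu, hp, hw⟩
  · rw [OnePoint.coe_eq_coe] at hz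
    subst hz
    exact Or.inl ⟨α, hα, _, rfl, by rw [p_neg_conj, h, map_zero]⟩
  · refine Or.inr ⟨ha, u, fun k => -(starRingEnd ℂ) (w k), hu, fun k => ?_, ?_⟩
    · rw [p_neg_conj, hp, map_zero]
    · have hw' : Tendsto w atTop (𝓝 z) :=
        (OnePoint.isOpenEmbedding_coe.isInducing.tendsto_nhds_iff).2 hw
      exact (OnePoint.continuous_coe.tendsto _).comp
        (((Complex.continuous_conj.tendsto z).comp hw').neg)

end

/-! ### The inside region is relatively open -/

theorem coe_mem_frontier_Icc_iff {a₁ a₂ : EReal} (ha : a₁ < a₂) {α : ℝ} :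
    (α : EReal) ∈ frontier (Icc a₁ a₂) ↔
      (α : EReal) ∈ Icc a₁ a₂ ∧ ((α : EReal) = a₁ ∨ (α : EReal) = a₂) := by
  rw [isClosed_Icc.frontier_eq, Set.mem_sdiff, and_congr_right_iff]
  intro hα
  rw [← Ici_inter_Iic, interior_inter, mem_inter_iff]
  have h1 : (α : EReal) ∈ interior (Ici a₁) ↔ (α : EReal) ≠ a₁ := by
    constructor
    · rintro h rfl
      rw [interior_Ici' ⟨⊥, EReal.bot_lt_coe α⟩] at h
      exact absurd (show (α : EReal) < α from h) (lt_irrefl _)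
    · intro h
      exact mem_interior.2 ⟨Ioi a₁, Ioi_subset_Ici_self, isOpen_Ioi, lt_of_le_of_ne hα.1 h.symm⟩
  have h2 : (α : EReal) ∈ interior (Iic a₂) ↔ (α : EReal) ≠ a₂ := by
    constructor
    · rintro h rfl
      rw [interior_Iic' ⟨⊤, EReal.coe_lt_top α⟩] at h
      exact absurd (show (α : EReal) < α from h) (lt_irrefl _)
    · intro h
      exact mem_interior.2 ⟨Iio a₂, Iio_subset_Iic_self, isOpen_Iio, lt_of_le_of_ne hα.2 h⟩
  rw [h1, h2]
  tauto

/-- The parameter rectangle. -/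
def rect (a₁ a₂ : EReal) (b₁ b₂ : ℝ) : Set (EReal × ℝ) := Icc a₁ a₂ ×ˢ Icc b₁ b₂

section Rect

variable {a₁ a₂ : EReal} {b₁ b₂ : ℝ}

theorem isClosed_rect : IsClosed (rect a₁ a₂ b₁ b₂) := isClosed_Icc.prod isClosed_Icc

theorem frontier_rect_subset : frontier (rect a₁ a₂ b₁ b₂) ⊆ rect a₁ a₂ b₁ b₂ :=
  isClosed_rect.frontier_subset

theorem frontier_rect (hb : b₁ < b₂) : frontier (rect a₁ a₂ b₁ b₂) =
    Icc a₁ a₂ ×ˢ {b₁, b₂} ∪ frontier (Icc a₁ a₂) ×ˢ Icc b₁ b₂ := by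
  rw [rect, frontier_prod_eq, frontier_Icc hb.le, isClosed_Icc.closure_eq, isClosed_Icc.closure_eq]

theorem mk_mem_frontier_rect_iff (ha : a₁ < a₂) (hb : b₁ < b₂) {α β : ℝ} :
    ((α : EReal), β) ∈ frontier (rect a₁ a₂ b₁ b₂) ↔ ((α : EReal), β) ∈ rect a₁ a₂ b₁ b₂ ∧
      ((α : EReal) = a₁ ∨ (α : EReal) = a₂ ∨ β = b₁ ∨ β = b₂) := by
  rw [frontier_rect hb]
  simp only [mem_union, mem_prod, coe_mem_frontier_Icc_iff ha, rect, mem_insert_iff,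
    mem_singleton_iff]
  constructor
  · rintro (⟨h1, rfl | rfl⟩ | ⟨⟨h1, h2⟩, h3⟩)
    · exact ⟨⟨h1, left_mem_Icc.2 hb.le⟩, by tauto⟩
    · exact ⟨⟨h1, right_mem_Icc.2 hb.le⟩, by tauto⟩
    · exact ⟨⟨h1, h3⟩, by tauto⟩
  · tauto

theorem abs_snd_le_of_mem_rect {x : EReal × ℝ} (hx : x ∈ rect a₁ a₂ b₁ b₂) :
    |x.2| ≤ max |b₁| |b₂| := abs_le_max_abs_abs hx.2.1 hx.2.2

/-- Either the boundary of the rectangle has a point with infinite `α`, or `α` is bounded on the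
rectangle, with a real left endpoint. -/
theorem exists_infinite_or_bounded (a₁ a₂ : EReal) (hab : a₁ < a₂) {b₁ b₂ : ℝ} (hb : b₁ < b₂) :
    (∃ a, (a = ⊤ ∨ a = ⊥) ∧ (a, b₁) ∈ frontier (rect a₁ a₂ b₁ b₂)) ∨
      ∃ α₁ : ℝ, a₁ = α₁ ∧ ∃ K, ∀ x ∈ rect a₁ a₂ b₁ b₂, ∃ α : ℝ, x.1 = α ∧ |α| ≤ K ∧ |x.2| ≤ K := by
  rw [frontier_rect hb]
  by_cases h1 : a₁ = ⊥
  · exact Or.inl ⟨a₁, Or.inr h1, Or.inl ⟨left_mem_Icc.2 hab.le, Or.inl rfl⟩⟩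
  by_cases h2 : a₂ = ⊤
  · exact Or.inl ⟨a₂, Or.inl h2, Or.inl ⟨right_mem_Icc.2 hab.le, Or.inl rfl⟩⟩
  right
  lift a₁ to ℝ using ⟨(hab.trans_le le_top).ne, h1⟩
  lift a₂ to ℝ using ⟨h2, (bot_le.trans_lt hab).ne'⟩
  refine ⟨a₁, rfl, max (max |a₁| |a₂|) (max |b₁| |b₂|), ?_⟩
  rintro ⟨a, β⟩ ⟨⟨h3, h4⟩, h5⟩
  simp only at h3 h4 h5
  lift a to ℝ using ⟨(h4.trans_lt (EReal.coe_lt_top a₂)).ne,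
    ((EReal.bot_lt_coe a₁).trans_le h3).ne'⟩
  rw [EReal.coe_le_coe_iff] at h3 h4
  exact ⟨a, rfl, (abs_le_max_abs_abs h3 h4).trans (le_max_left _ _),
    (abs_le_max_abs_abs h5.1 h5.2).trans (le_max_right _ _)⟩

end Rect

section Openness

variable {c d : ℝ} {a₁ a₂ : EReal} {b₁ b₂ : ℝ} {z : ℂ}

theorem coe_mem_closure_rect_iff (hd : 0 < d) (hz : z.re ≠ 0) (hR : res c d z ≠ 0) :
    (z : Sphere) ∈ offAxisClosure c d (rect a₁ a₂ b₁ b₂) ↔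
      den c d z ≠ 0 ∧ ((alphaOf c d z : EReal), betaOf c d z) ∈ rect a₁ a₂ b₁ b₂ :=
  coe_mem_offAxisClosure_iff hd isClosed_rect (fun _ hx => abs_snd_le_of_mem_rect hx) hz hR

theorem coe_mem_closure_frontier_iff (hd : 0 < d) (hz : z.re ≠ 0) (hR : res c d z ≠ 0) :
    (z : Sphere) ∈ offAxisClosure c d (frontier (rect a₁ a₂ b₁ b₂)) ↔
      den c d z ≠ 0 ∧
        ((alphaOf c d z : EReal), betaOf c d z) ∈ frontier (rect a₁ a₂ b₁ b₂) :=
  coe_mem_offAxisClosure_iff hd isClosed_frontier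
    (fun _ hx => abs_snd_le_of_mem_rect (frontier_rect_subset hx)) hz hR

theorem infty_mem_closure_frontier (hc : 0 ≤ c) (hd : 0 < d) (ha : a₁ < a₂) (hb : b₁ < b₂)
    (h : OnePoint.infty ∈ offAxisClosure c d (rect a₁ a₂ b₁ b₂)) :
    OnePoint.infty ∈ offAxisClosure c d (frontier (rect a₁ a₂ b₁ b₂)) := by
  rcases exists_infinite_or_bounded a₁ a₂ ha hb with ⟨a, ha', hx⟩ | ⟨-, -, K, hK⟩
  · exact infty_mem_offAxisClosure hd ha' hx
  · exact absurd h (infty_notMem_offAxisClosure hc hd hK)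

theorem coe_mem_closure_frontier_of_res_eq_zero (hd : 0 < d) (ha : a₁ < a₂) (hb : b₁ < b₂)
    (hz : z.re ≠ 0) (hR : res c d z = 0)
    (h : (z : Sphere) ∈ offAxisClosure c d (rect a₁ a₂ b₁ b₂)) :
    (z : Sphere) ∈ offAxisClosure c d (frontier (rect a₁ a₂ b₁ b₂)) := by
  rcases exists_infinite_or_bounded a₁ a₂ ha hb with ⟨a, ha', hx⟩ | ⟨α, rfl, K, hK⟩
  · exact coe_mem_offAxisClosure_of_res_eq_zero hd ha' hx hz hR
  have h1 : ∀ m : ℝ, 0 < m → ∃ x ∈ rect (α : EReal) a₂ b₁ b₂, |x.2| < m := fun m hm =>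
    exists_abs_lt_of_res_eq_zero hm hz
      (fun x hx => (hK x hx).imp fun _ h => ⟨h.1, h.2.1⟩) hR h
  have h2 : b₁ ≤ 0 := by
    by_contra! hb0
    obtain ⟨x, hx, hlt⟩ := h1 b₁ hb0
    have := hx.2.1
    rw [abs_of_nonneg (hb0.le.trans this)] at hlt
    linarith
  have h3 : 0 ≤ b₂ := by
    by_contra! hb0
    obtain ⟨x, hx, hlt⟩ := h1 (-b₂) (by linarith)
    have := hx.2.2
    rw [abs_of_nonpos (this.trans hb0.le)] at hlt
    linarith
  refine subset_closure ⟨⟨((α : EReal), 0), ?_, coe_mem_rootSet_coe.2 ?_⟩, by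
    rwa [coe_mem_imagAxis]⟩
  · rw [mk_mem_frontier_rect_iff ha hb]
    exact ⟨⟨left_mem_Icc.2 ha.le, h2, h3⟩, Or.inl rfl⟩
  · rw [res_eq_zero_iff] at hR
    rw [p, hR]; simp

theorem closure_rect_mem_nhds_of_re_ne_zero (hd : 0 < d) (ha : a₁ < a₂) (hb : b₁ < b₂)
    (hz : z.re ≠ 0) (hF : (z : Sphere) ∈ offAxisClosure c d (rect a₁ a₂ b₁ b₂))
    (hG : (z : Sphere) ∉ offAxisClosure c d (frontier (rect a₁ a₂ b₁ b₂))) :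
    ∀ᶠ w : ℂ in 𝓝 z, (w : Sphere) ∈ offAxisClosure c d (rect a₁ a₂ b₁ b₂) := by
  have hR : res c d z ≠ 0 := fun hR =>
    hG (coe_mem_closure_frontier_of_res_eq_zero hd ha hb hz hR hF)
  obtain ⟨hD, hx⟩ := (coe_mem_closure_rect_iff hd hz hR).1 hF
  have hxi : ((alphaOf c d z : EReal), betaOf c d z) ∈ interior (rect a₁ a₂ b₁ b₂) := by
    by_contra hnot
    exact hG ((coe_mem_closure_frontier_iff hd hz hR).2 ⟨hD, subset_closure hx, hnot⟩)
  filter_upwards [(continuousAt_params hD).eventually (isOpen_interior.mem_nhds hxi),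
    continuous_den.continuousAt.eventually_ne hD, continuous_res.continuousAt.eventually_ne hR,
    Complex.continuous_re.continuousAt.eventually_ne hz] with w h1 h2 h3 h4
  exact (coe_mem_closure_rect_iff hd h4 h3).2 ⟨h2, interior_subset h1⟩

/-- On the imaginary axis: each of the two half balls around a point off `G` lies inside or
outside, and by reflection both do the same. -/
theorem closure_rect_mem_nhds_of_re_eq_zero (hd : 0 < d) (ha : a₁ < a₂) (hb : b₁ < b₂)
    (hz : z.re = 0) (hF : (z : Sphere) ∈ offAxisClosure c d (rect a₁ a₂ b₁ b₂))
    (hG : (z : Sphere) ∉ offAxisClosure c d (frontier (rect a₁ a₂ b₁ b₂))) :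
    ∀ᶠ w : ℂ in 𝓝 z, (w : Sphere) ∈ offAxisClosure c d (rect a₁ a₂ b₁ b₂) := by
  set F := offAxisClosure c d (rect a₁ a₂ b₁ b₂) with hFdef
  set G := offAxisClosure c d (frontier (rect a₁ a₂ b₁ b₂)) with hGdef
  have hFcl : IsClosed (((↑) : ℂ → Sphere) ⁻¹' F) :=
    isClosed_offAxisClosure.preimage OnePoint.continuous_coe
  have hGo : IsOpen (((↑) : ℂ → Sphere) ⁻¹' G)ᶜ :=
    (isClosed_offAxisClosure.preimage OnePoint.continuous_coe).isOpen_compl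
  obtain ⟨ε, hε, hball⟩ := Metric.isOpen_iff.1 hGo z hG
  have hhalf : ∀ H : Set ℂ, Convex ℝ H → (∀ w ∈ H, w.re ≠ 0) →
      ∀ w ∈ Metric.ball z ε ∩ H, (w : Sphere) ∈ F →
        Metric.ball z ε ∩ H ⊆ ((↑) : ℂ → Sphere) ⁻¹' F := by
    intro H hH hre w hw hwF
    have hpre : IsPreconnected (Metric.ball z ε ∩ H) :=
      ((convex_ball z ε).inter hH).isPreconnected
    have hsub := hpre.subset_of_closure_inter_subset
      (u := interior (((↑) : ℂ → Sphere) ⁻¹' F)) isOpen_interior ?_ ?_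
    · exact hsub.trans interior_subset
    · exact ⟨w, hw, mem_interior_iff_mem_nhds.2
        (closure_rect_mem_nhds_of_re_ne_zero hd ha hb (hre w hw.2) hwF (hball hw.1))⟩
    · rintro v ⟨hv, hvB, hvH⟩
      have hvF : v ∈ ((↑) : ℂ → Sphere) ⁻¹' F :=
        closure_minimal interior_subset hFcl hv
      exact mem_interior_iff_mem_nhds.2
        (closure_rect_mem_nhds_of_re_ne_zero hd ha hb (hre v hvH) hvF (hball hvB))
  have hpos := hhalf {w | 0 < w.re} (convex_halfSpace_re_gt 0) fun w hw => ne_of_gt hw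
  have hneg := hhalf {w | w.re < 0} (convex_halfSpace_re_lt 0) fun w hw => ne_of_lt hw
  -- a root near `z` off the axis, and its mirror image
  obtain ⟨w, ⟨hwre, hwW⟩, hwB⟩ := ((frequently_of_mem_offAxisClosure hF).and_eventually
    (Metric.ball_mem_nhds z hε)).exists
  set w' : ℂ := -(starRingEnd ℂ) w with hw'
  have hw're : w'.re = -w.re := by simp [hw']
  have hw'B : w' ∈ Metric.ball z ε := by
    have hwB' : dist w z < ε := hwB
    rw [dist_eq_norm] at hwB'
    rw [Metric.mem_ball, dist_eq_norm]
    have h1 : w' - z = -(starRingEnd ℂ) (w - z) := by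
      apply Complex.ext <;> simp [hw', hz, neg_add_eq_sub]
    rwa [h1, norm_neg, Complex.norm_conj]
  have hmemF : ∀ v : ℂ, v.re ≠ 0 → (v : Sphere) ∈ W c d (rect a₁ a₂ b₁ b₂) → (v : Sphere) ∈ F :=
    fun v hv hvW => subset_closure ⟨hvW, by rwa [coe_mem_imagAxis]⟩
  have hwF := hmemF w hwre hwW
  have hw'F := hmemF w' (by rw [hw're]; exact neg_ne_zero.2 hwre) (neg_conj_mem_W hwW)
  have hboth : ∀ v ∈ Metric.ball z ε, v.re ≠ 0 → (v : Sphere) ∈ F := by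
    intro v hv hvre
    rcases lt_or_gt_of_ne hvre with hlt | hgt <;> rcases lt_or_gt_of_ne hwre with hwlt | hwgt
    · exact hneg w ⟨hwB, hwlt⟩ hwF ⟨hv, hlt⟩
    · exact hneg w' ⟨hw'B, by rw [mem_ofPred_eq, hw're]; linarith⟩ hw'F ⟨hv, hlt⟩
    · exact hpos w' ⟨hw'B, by rw [mem_ofPred_eq, hw're]; linarith⟩ hw'F ⟨hv, hgt⟩
    · exact hpos w ⟨hwB, hwgt⟩ hwF ⟨hv, hgt⟩
  filter_upwards [Metric.ball_mem_nhds z hε] with v hv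
  by_cases hvre : v.re ≠ 0
  · exact hboth v hv hvre
  · have hdense : Dense {u : ℂ | u.re ≠ 0} := by
      have := (dense_compl_singleton (0 : ℝ)).preimage Complex.isOpenMap_re
      exact this
    have h1 : v ∈ closure (Metric.ball z ε ∩ {u : ℂ | u.re ≠ 0}) :=
      hdense.open_subset_closure_inter Metric.isOpen_ball hv
    exact closure_minimal (fun u hu => hboth u hu.1 hu.2) hFcl h1

/-- The boundary of `F` is contained in `G`. -/
theorem isOpen_closure_rect_diff (hc : 0 ≤ c) (hd : 0 < d) (ha : a₁ < a₂) (hb : b₁ < b₂) :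
    IsOpen (offAxisClosure c d (rect a₁ a₂ b₁ b₂) \
      offAxisClosure c d (frontier (rect a₁ a₂ b₁ b₂))) := by
  rw [isOpen_iff_mem_nhds]
  rintro ω ⟨hF, hG⟩
  refine inter_mem ?_ (isClosed_offAxisClosure.isOpen_compl.mem_nhds hG)
  induction ω using OnePoint.rec with
  | infty => exact absurd (infty_mem_closure_frontier hc hd ha hb hF) hG
  | coe z =>
    rw [OnePoint.nhds_coe_eq]
    by_cases hz : z.re = 0
    · exact closure_rect_mem_nhds_of_re_eq_zero hd ha hb hz hF hG
    · exact closure_rect_mem_nhds_of_re_ne_zero hd ha hb hz hF hG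

end Openness

/-! ### The boundary curves -/

/-- The equation of the curve `α = a`, cleared of its denominator. -/
def curveA (c d a : ℝ) (z : ℂ) : ℝ := sqMod z ^ 2 * (d + 2 * z.im) - a * den c d z

/-- The equation of the curve `β = b`, cleared of its denominator. -/
def curveB (c d b : ℝ) (z : ℂ) : ℝ := -2 * z.im * res c d z - b * den c d z

/-- The discriminant of `curveA` as a quadratic polynomial in `|z|²`, for fixed `Im z = y`. -/
def discA (c d a y : ℝ) : ℝ := (a * d) ^ 2 + 8 * a * c * y * (d + 2 * y)

/-- The linear coefficient of `curveB` as a quadratic polynomial in `|z|²`, for fixed `Im z = y`. -/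
def linB (c d b y : ℝ) : ℝ := 4 * c * y - 2 * d * y * (d + 2 * y) - b * d

/-- The discriminant of `curveB` as a quadratic polynomial in `|z|²`, for fixed `Im z = y`. -/
def discB (c d b y : ℝ) : ℝ :=
  linB c d b y ^ 2 - 16 * c * y ^ 2 * (c + 2 * y * (d + 2 * y) + b)

variable {c d a b : ℝ} {z : ℂ}

theorem curveA_eq (c d a : ℝ) (z : ℂ) : curveA c d a z =
    (d + 2 * z.im) * sqMod z ^ 2 + (-(a * d)) * sqMod z + -(2 * a * c * z.im) := by
  simp only [curveA, den]; ring

theorem curveB_eq (c d b : ℝ) (z : ℂ) : curveB c d b z =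
    (-2 * z.im) * sqMod z ^ 2 + linB c d b z.im * sqMod z +
      -(2 * c * z.im * (c + 2 * z.im * (d + 2 * z.im) + b)) := by
  simp only [curveB, den, res, linB]; ring

theorem curveA_of_den_ne_zero (hD : den c d z ≠ 0) :
    curveA c d a z = (alphaOf c d z - a) * den c d z := by
  unfold curveA alphaOf; field_simp

theorem curveB_of_den_ne_zero (hD : den c d z ≠ 0) :
    curveB c d b z = (betaOf c d z - b) * den c d z := by
  unfold curveB betaOf; field_simp

section FiniteSets

theorem finite_setOf_sum_eq_zero {n : ℕ} (k : Fin n → ℝ) (hk : k ≠ 0) :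
    {y : ℝ | ∑ i, k i * y ^ (i : ℕ) = 0}.Finite := by
  open Polynomial in
  set q : ℝ[X] := ∑ i, C (k i) * X ^ (i : ℕ) with hq
  have hq0 : q ≠ 0 := by
    intro h0
    apply hk
    funext j
    have h1 : q.coeff j = k j := by
      rw [hq, finsetSum_coeff]
      simp only [coeff_C_mul_X_pow]
      rw [Finset.sum_eq_single j]
      · simp
      · intro i _ hij
        rw [if_neg]
        exact fun h => hij (Fin.ext h.symm)
      · simp
    rw [← h1, h0]; simp
  refine (finite_setOfPred_isRoot hq0).subset fun y hy => ?_
  have hy' : ∑ i, k i * y ^ (i : ℕ) = 0 := hy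
  show q.IsRoot y
  rw [IsRoot.def, hq, eval_finsetSum, ← hy']
  simp

theorem finite_setOf_quadratic_sq {A B C s : ℝ} (h : A ≠ 0 ∨ B ≠ 0) :
    {x : ℝ | A * (x ^ 2 + s) ^ 2 + B * (x ^ 2 + s) + C = 0}.Finite := by
  refine (finite_setOf_sum_eq_zero ![A * s ^ 2 + B * s + C, 0, 2 * A * s + B, 0, A] ?_).subset ?_
  · intro h0
    have h4 : A = 0 := by simpa using congrFun h0 4
    have h2 : 2 * A * s + B = 0 := by simpa using congrFun h0 2
    rw [h4] at h2
    rcases h with h | h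
    · exact h h4
    · exact h (by linarith)
  · intro x hx
    refine Eq.trans ?_ hx
    simp [Fin.sum_univ_succ]
    ring

theorem finite_of_im_re {T : Set ℂ} {Y : Set ℝ} (hY : Y.Finite)
    (hT : ∀ z ∈ T, z.im ∈ Y) (hx : ∀ y ∈ Y, {x : ℝ | (⟨x, y⟩ : ℂ) ∈ T}.Finite) : T.Finite := by
  refine (hY.biUnion fun y hy => (hx y hy).image fun x : ℝ => (⟨x, y⟩ : ℂ)).subset ?_
  intro z hz
  exact mem_biUnion (hT z hz) ⟨z.re, hz, rfl⟩

theorem finite_setOf_p_eq_zero (c d α β : ℝ) : {z : ℂ | p c d α β z = 0}.Finite := by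
  classical
  obtain ⟨s, -, hs⟩ := exists_roots c d α β
  refine s.toFinset.finite_toSet.subset fun z hz => ?_
  rw [mem_ofPred_eq, hs, Multiset.prod_eq_zero_iff, Multiset.mem_map] at hz
  obtain ⟨r, hr, h⟩ := hz
  rw [sub_eq_zero] at h
  simpa [h] using hr

theorem finite_setOf_res_eq_zero (c d : ℝ) : {z : ℂ | res c d z = 0}.Finite := by
  refine (finite_setOf_p_eq_zero c d 0 0).subset fun z hz => ?_
  rw [mem_ofPred_eq, res_eq_zero_iff] at hz
  rw [mem_ofPred_eq, p, hz]; simp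

theorem finite_setOf_curveA_re_eq_zero (c d a : ℝ) :
    {z : ℂ | z.re = 0 ∧ curveA c d a z = 0}.Finite := by
  have h : {y : ℝ | ∑ i, ![0, -(2 * a * c), -(a * d), 0, d, 2] i * y ^ (i : ℕ) = 0}.Finite := by
    refine finite_setOf_sum_eq_zero _ fun h0 => ?_
    have : (2 : ℝ) = 0 := by simpa using congrFun h0 5
    norm_num at this
  refine (h.image fun y : ℝ => (⟨0, y⟩ : ℂ)).subset ?_
  rintro z ⟨hz, h0⟩
  refine ⟨z.im, ?_, Complex.ext hz.symm rfl⟩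
  refine Eq.trans ?_ h0
  rw [curveA_eq]
  simp [Fin.sum_univ_succ, sqMod, hz]
  ring

theorem finite_setOf_curveB_re_eq_zero (c d b : ℝ) :
    {z : ℂ | z.re = 0 ∧ curveB c d b z = 0}.Finite := by
  have h : {y : ℝ | ∑ i, ![0, -(2 * c ^ 2 + 2 * c * b), -(4 * c * d + b * d),
      -(4 * c + 2 * d ^ 2), -(4 * d), -2] i * y ^ (i : ℕ) = 0}.Finite := by
    refine finite_setOf_sum_eq_zero _ fun h0 => ?_
    have : (-2 : ℝ) = 0 := by simpa using congrFun h0 5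
    norm_num at this
  refine (h.image fun y : ℝ => (⟨0, y⟩ : ℂ)).subset ?_
  rintro z ⟨hz, h0⟩
  refine ⟨z.im, ?_, Complex.ext hz.symm rfl⟩
  refine Eq.trans ?_ h0
  rw [curveB_eq]
  simp [Fin.sum_univ_succ, sqMod, hz, linB]
  ring

theorem finite_setOf_discA (hd : 0 < d) (ha : a ≠ 0) :
    {z : ℂ | curveA c d a z = 0 ∧ discA c d a z.im = 0}.Finite := by
  have h : {y : ℝ | discA c d a y = 0}.Finite := by
    refine (finite_setOf_sum_eq_zero ![(a * d) ^ 2, 8 * a * c * d, 16 * a * c] ?_).subset ?_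
    · intro h0
      have : a = 0 ∨ d = 0 := by simpa using congrFun h0 0
      exact this.elim ha hd.ne'
    · intro y hy
      refine Eq.trans ?_ hy
      simp [Fin.sum_univ_succ, discA]
      ring
  refine finite_of_im_re h (fun z hz => hz.2) fun y _ => ?_
  refine (finite_setOf_quadratic_sq (A := d + 2 * y) (B := -(a * d))
    (C := -(2 * a * c * y)) (s := y ^ 2)
    (Or.inr (neg_ne_zero.2 (mul_ne_zero ha hd.ne')))).subset fun x hx => ?_
  have := hx.1
  rw [curveA_eq] at this
  exact this

theorem finite_setOf_discB (hd : 0 < d) (hb : b ≠ 0) :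
    {z : ℂ | curveB c d b z = 0 ∧ discB c d b z.im = 0}.Finite := by
  have h : {y : ℝ | discB c d b y = 0}.Finite := by
    refine (finite_setOf_sum_eq_zero ![(b * d) ^ 2, -(2 * b * d) * (4 * c - 2 * d ^ 2),
      (4 * c - 2 * d ^ 2) ^ 2 + 8 * d ^ 2 * b - 16 * c ^ 2 - 16 * c * b,
      -(8 * d) * (4 * c - 2 * d ^ 2) - 32 * c * d, 16 * d ^ 2 - 64 * c] ?_).subset ?_
    · intro h0
      have : b = 0 ∨ d = 0 := by simpa using congrFun h0 0
      exact this.elim hb hd.ne'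
    · intro y hy
      refine Eq.trans ?_ hy
      simp [Fin.sum_univ_succ, discB, linB]
      ring
  refine finite_of_im_re h (fun z hz => hz.2) fun y _ => ?_
  refine (finite_setOf_quadratic_sq (A := -2 * y) (B := linB c d b y)
    (C := -(2 * c * y * (c + 2 * y * (d + 2 * y) + b))) (s := y ^ 2) ?_).subset fun x hx => ?_
  · by_cases hy : y = 0
    · right
      rw [linB, hy]
      simpa using ⟨hb, hd.ne'⟩
    · left
      simpa using hy
  · have := hx.1
    rw [curveB_eq] at this
    exact this

end FiniteSets

section Regular

theorem contDiff_sqMod : ContDiff ℝ 1 sqMod := by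
  have h1 : ContDiff ℝ 1 Complex.re := Complex.reCLM.contDiff
  have h2 : ContDiff ℝ 1 Complex.im := Complex.imCLM.contDiff
  unfold sqMod; fun_prop

theorem contDiff_den : ContDiff ℝ 1 (den c d) := by
  have h1 : ContDiff ℝ 1 sqMod := contDiff_sqMod
  have h2 : ContDiff ℝ 1 Complex.im := Complex.imCLM.contDiff
  unfold den; fun_prop

theorem contDiff_res : ContDiff ℝ 1 (res c d) := by
  have h1 : ContDiff ℝ 1 sqMod := contDiff_sqMod
  have h2 : ContDiff ℝ 1 Complex.im := Complex.imCLM.contDiff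
  have h3 : ContDiff ℝ 1 (den c d) := contDiff_den
  unfold res; fun_prop

theorem contDiff_curveA : ContDiff ℝ 1 (curveA c d a) := by
  have h1 : ContDiff ℝ 1 sqMod := contDiff_sqMod
  have h2 : ContDiff ℝ 1 Complex.im := Complex.imCLM.contDiff
  have h3 : ContDiff ℝ 1 (den c d) := contDiff_den
  unfold curveA; fun_prop

theorem contDiff_curveB : ContDiff ℝ 1 (curveB c d b) := by
  have h1 : ContDiff ℝ 1 (res c d) := contDiff_res
  have h2 : ContDiff ℝ 1 Complex.im := Complex.imCLM.contDiff
  have h3 : ContDiff ℝ 1 (den c d) := contDiff_den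
  unfold curveB; fun_prop

/-- `f` vanishes at `g` with a non-zero derivative in the direction `v`. -/
def IsRegularZero (f : ℂ → ℝ) (g v : ℂ) : Prop :=
  ContDiff ℝ 1 f ∧ f g = 0 ∧ fderiv ℝ f g v ≠ 0

theorem IsRegularZero.mul {f h : ℂ → ℝ} {g v : ℂ} (hf : IsRegularZero f g v)
    (hh : ContDiff ℝ 1 h) (hg : h g ≠ 0) : IsRegularZero (fun z => f z * h z) g v := by
  obtain ⟨h1, h2, h3⟩ := hf
  refine ⟨h1.mul hh, by simp [h2], ?_⟩
  rw [fderiv_fun_mul (h1.differentiable one_ne_zero g) (hh.differentiable one_ne_zero g)]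
  simpa [h2] using ⟨hg, h3⟩

theorem hasDerivAt_comp_line {f : ℂ → ℝ} (hf : ContDiff ℝ 1 f) (g v : ℂ) :
    HasDerivAt (fun t : ℝ => f (g + t * v)) (fderiv ℝ f g v) 0 := by
  have h1 : HasDerivAt (fun t : ℝ => g + t * v) v 0 := by
    have := ((hasDerivAt_id (0 : ℝ)).ofReal_comp.mul_const v).const_add g
    simpa using this
  have h2 : HasFDerivAt f (fderiv ℝ f g) (g + ((0 : ℝ) : ℂ) * v) := by
    simpa using (hf.differentiable one_ne_zero g).hasFDerivAt
  exact h2.comp_hasDerivAt 0 h1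

theorem isRegularZero_of_quadratic {f : ℂ → ℝ} {A B C : ℝ → ℝ} (hf : ContDiff ℝ 1 f)
    (hq : ∀ z : ℂ, f z = A z.im * sqMod z ^ 2 + B z.im * sqMod z + C z.im) (hz : z.re ≠ 0)
    (h0 : f z = 0) (hdisc : B z.im ^ 2 - 4 * A z.im * C z.im ≠ 0) : IsRegularZero f z 1 := by
  refine ⟨hf, h0, ?_⟩
  have h1 := hasDerivAt_comp_line hf z 1
  have h2 : HasDerivAt (fun t : ℝ => (z.re + t) ^ 2 + z.im ^ 2) (2 * z.re) 0 := by
    have := (((hasDerivAt_id (0 : ℝ)).const_add z.re).pow 2).add_const (z.im ^ 2)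
    simpa using this
  have h3 := (((h2.pow 2).const_mul (A z.im)).add (h2.const_mul (B z.im))).add_const (C z.im)
  have h4 : (fun t : ℝ => f (z + t * 1)) = fun t : ℝ => A z.im * ((z.re + t) ^ 2 + z.im ^ 2) ^ 2 +
      B z.im * ((z.re + t) ^ 2 + z.im ^ 2) + C z.im := by
    funext t
    rw [hq]
    simp [sqMod]
  rw [h4] at h1
  rw [h1.unique h3]
  intro h5
  apply hdisc
  rw [hq, sqMod] at h0
  have h6 : 2 * A z.im * (z.re ^ 2 + z.im ^ 2) + B z.im = 0 := by
    refine (mul_eq_zero.1 (?_ : 2 * z.re *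
      (2 * A z.im * (z.re ^ 2 + z.im ^ 2) + B z.im) = 0)).resolve_left (by simpa using hz)
    rw [← h5]
    simp
    ring
  linear_combination (2 * A z.im * (z.re ^ 2 + z.im ^ 2) + B z.im) * h6 - 4 * A z.im * h0

/-- The curve `α = a` is regular. For `a = 0` it is the line `Im z = -d/2`, to which only the
vertical direction is transversal. -/
theorem exists_isRegularZero_curveA (hz : z.re ≠ 0) (h0 : curveA c d a z = 0)
    (hdisc : a ≠ 0 → discA c d a z.im ≠ 0) :
    ∃ v, IsRegularZero (curveA c d a) z v ∧ (z.im ≠ -d / 2 → v = 1) := by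
  by_cases ha : a = 0
  · subst ha
    have hr := sqMod_pos hz
    have hy : d + 2 * z.im = 0 := by
      simp only [curveA, zero_mul, sub_zero, mul_eq_zero] at h0
      exact h0.resolve_left (by positivity)
    refine ⟨Complex.I, ⟨contDiff_curveA, h0, ?_⟩, fun h => absurd (by linarith) h⟩
    have h1 := hasDerivAt_comp_line (contDiff_curveA (c := c) (d := d) (a := 0)) z Complex.I
    have h2 : HasDerivAt (fun t : ℝ => d + 2 * (z.im + t)) 2 0 := by
      have := (((hasDerivAt_id (0 : ℝ)).const_add z.im).const_mul 2).const_add d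
      simpa using this
    have h3 := ((hasDerivAt_comp_line contDiff_sqMod z Complex.I).pow 2).mul h2
    have h4 : (fun t : ℝ => curveA c d 0 (z + t * Complex.I)) =
        ((fun t : ℝ => sqMod (z + t * Complex.I)) ^ 2 * fun t : ℝ => d + 2 * (z.im + t)) := by
      funext t
      simp [curveA]
    rw [h4] at h1
    rw [h1.unique h3]
    simp [hy, hr.ne']
  · refine ⟨1, ?_, fun _ => rfl⟩
    refine isRegularZero_of_quadratic (A := fun y => d + 2 * y) (B := fun _ => -(a * d))
      (C := fun y => -(2 * a * c * y)) contDiff_curveA (curveA_eq c d a) hz h0 ?_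
    intro h
    refine hdisc ha ?_
    rw [← h, discA]; ring

/-- The curve `β = b` is regular. For `b = 0` it is the real line, to which only the vertical
direction is transversal. -/
theorem exists_isRegularZero_curveB (hz : z.re ≠ 0) (hR : res c d z ≠ 0)
    (h0 : curveB c d b z = 0) (hdisc : b ≠ 0 → discB c d b z.im ≠ 0) :
    ∃ v, IsRegularZero (curveB c d b) z v ∧ (z.im ≠ 0 → v = 1) := by
  by_cases hb : b = 0
  · subst hb
    have hy : z.im = 0 := by
      simp only [curveB, zero_mul, sub_zero, mul_eq_zero] at h0
      rcases h0 with (h | h) | h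
      · norm_num at h
      · exact h
      · exact absurd h hR
    refine ⟨Complex.I, ⟨contDiff_curveB, h0, ?_⟩, fun h => absurd hy h⟩
    have h1 := hasDerivAt_comp_line (contDiff_curveB (c := c) (d := d) (b := 0)) z Complex.I
    have h2 : HasDerivAt (fun t : ℝ => -2 * (z.im + t)) (-2) 0 := by
      have := ((hasDerivAt_id (0 : ℝ)).const_add z.im).const_mul (-2)
      simpa using this
    have h3 := h2.mul (hasDerivAt_comp_line (contDiff_res (c := c) (d := d)) z Complex.I)
    have h4 : (fun t : ℝ => curveB c d 0 (z + t * Complex.I)) =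
        ((fun t : ℝ => -2 * (z.im + t)) * fun t : ℝ => res c d (z + t * Complex.I)) := by
      funext t
      simp [curveB]
    rw [h4] at h1
    rw [h1.unique h3]
    simp [hy, hR]
  · refine ⟨1, ?_, fun _ => rfl⟩
    refine isRegularZero_of_quadratic (A := fun y => -2 * y) (B := fun y => linB c d b y)
      (C := fun y => -(2 * c * y * (c + 2 * y * (d + 2 * y) + b))) contDiff_curveB
      (curveB_eq c d b) hz h0 ?_
    intro h
    refine hdisc hb ?_
    rw [← h, discB]; ring

/-- Moving in a transversal direction, both signs of `f` occur arbitrarily close to a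
regular zero. -/
theorem IsRegularZero.exists_pos_neg {f : ℂ → ℝ} {g v : ℂ} (hf : IsRegularZero f g v) {N : Set ℂ}
    (hN : N ∈ 𝓝 g) :
    (∃ t : ℝ, g + t * v ∈ N ∧ 0 < f (g + t * v)) ∧ ∃ t : ℝ, g + t * v ∈ N ∧ f (g + t * v) < 0 := by
  obtain ⟨h1, h2, h3⟩ := hf
  have hder := hasDerivAt_comp_line h1 g v
  have hline : ContinuousAt (fun t : ℝ => g + t * v) 0 := by fun_prop
  have hNt : ∀ᶠ t : ℝ in 𝓝 0, g + t * v ∈ N := hline (by simpa using hN)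
  have hpos : ∀ (f : ℂ → ℝ) (m : ℝ), f g = 0 →
      HasDerivAt (fun t : ℝ => f (g + t * v)) m 0 → m ≠ 0 →
      ∃ t : ℝ, g + t * v ∈ N ∧ 0 < f (g + t * v) := by
    intro f m hfg hder hm
    have hslope := hder.tendsto_slope_zero
    simp only [zero_add, Complex.ofReal_zero, zero_mul, add_zero, hfg, sub_zero,
      smul_eq_mul] at hslope
    rcases lt_or_gt_of_ne hm with hlt | hgt
    · have hev := (hslope.mono_left (nhdsLT_le_nhdsNE 0)).eventually (gt_mem_nhds hlt)
      obtain ⟨t, ⟨ht1, ht2⟩, ht3⟩ := ((hev.and (hNt.filter_mono nhdsWithin_le_nhds)).and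
        self_mem_nhdsWithin).exists
      have ht3' : t < 0 := ht3
      refine ⟨t, ht2, ?_⟩
      have := mul_pos_of_neg_of_neg ht3' ht1
      rwa [mul_inv_cancel_left₀ ht3'.ne] at this
    · have hev := (hslope.mono_left (nhdsGT_le_nhdsNE 0)).eventually (lt_mem_nhds hgt)
      obtain ⟨t, ⟨ht1, ht2⟩, ht3⟩ := ((hev.and (hNt.filter_mono nhdsWithin_le_nhds)).and
        self_mem_nhdsWithin).exists
      have ht3' : 0 < t := ht3
      refine ⟨t, ht2, ?_⟩
      have := mul_pos ht3' ht1
      rwa [mul_inv_cancel_left₀ ht3'.ne'] at this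
  refine ⟨hpos f _ h2 hder h3, ?_⟩
  obtain ⟨t, ht1, ht2⟩ := hpos (fun z => -f z) _ (by simp [h2]) hder.neg (neg_ne_zero.2 h3)
  exact ⟨t, ht1, by linarith⟩

end Regular

/-! ### The local structure of the boundary -/

section LocalStructure

variable {c d : ℝ} {a₁ a₂ : EReal} {b₁ b₂ : ℝ} {z g : ℂ}

/-- The boundary of the rectangle is mapped into four algebraic curves. For an infinite endpoint
`aᵢ` the junk value `aᵢ.toReal = 0` only enlarges the union. -/
theorem mem_curves_of_mem_closure_frontier (ha : a₁ < a₂) (hb : b₁ < b₂)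
    (h : (z : Sphere) ∈ offAxisClosure c d (frontier (rect a₁ a₂ b₁ b₂))) :
    (curveA c d a₁.toReal z = 0 ∨ curveA c d a₂.toReal z = 0) ∨
      curveB c d b₁ z = 0 ∨ curveB c d b₂ z = 0 := by
  have hcl : IsClosed {z : ℂ | (curveA c d a₁.toReal z = 0 ∨ curveA c d a₂.toReal z = 0) ∨
      curveB c d b₁ z = 0 ∨ curveB c d b₂ z = 0} := by
    have hA : ∀ a, IsClosed {z : ℂ | curveA c d a z = 0} := fun a =>
      isClosed_eq contDiff_curveA.continuous continuous_const
    have hB : ∀ b, IsClosed {z : ℂ | curveB c d b z = 0} := fun b =>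
      isClosed_eq contDiff_curveB.continuous continuous_const
    exact ((hA _).union (hA _)).union ((hB _).union (hB _))
  refine mem_of_mem_offAxisClosure hcl ?_ h
  rintro w hw ⟨⟨a, β⟩, hx, hω⟩
  have hinf : a = ⊤ ∨ a = ⊥ → curveB c d b₁ w = 0 := by
    intro ha'
    have hR := res_eq_zero_of_mem_rootSet ha' hω
    have hP := res_eq_zero_iff.1 hR
    have him := congrArg Complex.im hP
    have hy : d + 2 * w.im = 0 := by
      refine (mul_eq_zero.1 (?_ : w.re * (d + 2 * w.im) = 0)).resolve_left hw
      simp [pow_two] at him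
      linear_combination -him
    have hr : c - sqMod w = 0 := by
      have h1 := hR
      rw [res, hy, zero_mul, add_zero] at h1
      exact pow_eq_zero_iff two_ne_zero |>.1 h1
    have hD : den c d w = 0 := by
      rw [den, ← sub_eq_zero.1 hr]
      linear_combination c * hy
    rw [curveB, hR, hD]; ring
  induction a using EReal.rec with
  | bot => exact Or.inr (Or.inl (hinf (Or.inr rfl)))
  | top => exact Or.inr (Or.inl (hinf (Or.inl rfl)))
  | coe α =>
    obtain ⟨h1, h2⟩ := mul_den_of_p_eq_zero hw (coe_mem_rootSet_coe.1 hω)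
    rcases ((mk_mem_frontier_rect_iff ha hb).1 hx).2 with h3 | h3 | h3 | h3
    · refine Or.inl (Or.inl ?_)
      rw [← h3, EReal.toReal_coe, curveA, h1, sub_self]
    · refine Or.inl (Or.inr ?_)
      rw [← h3, EReal.toReal_coe, curveA, h1, sub_self]
    · refine Or.inr (Or.inl ?_)
      rw [← h3, curveB, h2, sub_self]
    · refine Or.inr (Or.inr ?_)
      rw [← h3, curveB, h2, sub_self]

/-- The finite points at which `G` may fail to be a regular curve: its points on the imaginary
axis, the zeros of `c - i d z - z²`, the roots for the corners of the rectangle, and the points at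
which one of the curves, unless it contains a horizontal line, is singular or has a horizontal
tangent. -/
def exceptionalSet (c d : ℝ) (a₁ a₂ : EReal) (b₁ b₂ : ℝ) : Set ℂ :=
  {z | z.re = 0 ∧ (z : Sphere) ∈ offAxisClosure c d (frontier (rect a₁ a₂ b₁ b₂))} ∪
    {z | res c d z = 0} ∪
    ⋃ a ∈ ({a₁.toReal, a₂.toReal} : Set ℝ), ⋃ b ∈ ({b₁, b₂} : Set ℝ),
      ({z | p c d a b z = 0} ∪ {z | a ≠ 0 ∧ curveA c d a z = 0 ∧ discA c d a z.im = 0} ∪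
        {z | b ≠ 0 ∧ curveB c d b z = 0 ∧ discB c d b z.im = 0})

theorem finite_exceptionalSet (hd : 0 < d) (ha : a₁ < a₂) (hb : b₁ < b₂) :
    (exceptionalSet c d a₁ a₂ b₁ b₂).Finite := by
  refine (Finite.union ?_ (finite_setOf_res_eq_zero c d)).union ?_
  · refine (((finite_setOf_curveA_re_eq_zero c d a₁.toReal).union
      (finite_setOf_curveA_re_eq_zero c d a₂.toReal)).union
      ((finite_setOf_curveB_re_eq_zero c d b₁).union
      (finite_setOf_curveB_re_eq_zero c d b₂))).subset ?_
    rintro z ⟨hz, hzG⟩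
    rcases mem_curves_of_mem_closure_frontier ha hb hzG with (h | h) | h | h
    · exact Or.inl (Or.inl ⟨hz, h⟩)
    · exact Or.inl (Or.inr ⟨hz, h⟩)
    · exact Or.inr (Or.inl ⟨hz, h⟩)
    · exact Or.inr (Or.inr ⟨hz, h⟩)
  · refine Finite.biUnion (toFinite _) fun a _ => Finite.biUnion (toFinite _) fun b _ => ?_
    refine ((finite_setOf_p_eq_zero c d a b).union ?_).union ?_
    · by_cases h : a = 0
      · simp [h]
      · exact (finite_setOf_discA hd h).subset fun z hz => hz.2
    · by_cases h : b = 0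
      · simp [h]
      · exact (finite_setOf_discB hd h).subset fun z hz => hz.2

theorem mem_exceptionalSet_of_corner {a b : ℝ} (ha : a = a₁.toReal ∨ a = a₂.toReal)
    (hb : b = b₁ ∨ b = b₂) (h : p c d a b z = 0) : z ∈ exceptionalSet c d a₁ a₂ b₁ b₂ :=
  Or.inr (mem_biUnion ha (mem_biUnion hb (Or.inl (Or.inl h))))

theorem mem_exceptionalSet_of_discA {a : ℝ} (ha : a = a₁.toReal ∨ a = a₂.toReal) (ha0 : a ≠ 0)
    (h : curveA c d a z = 0) (h' : discA c d a z.im = 0) :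
    z ∈ exceptionalSet c d a₁ a₂ b₁ b₂ :=
  Or.inr (mem_biUnion ha (mem_biUnion (Or.inl rfl : b₁ ∈ ({b₁, b₂} : Set ℝ))
    (Or.inl (Or.inr ⟨ha0, h, h'⟩))))

theorem mem_exceptionalSet_of_discB {b : ℝ} (hb : b = b₁ ∨ b = b₂) (hb0 : b ≠ 0)
    (h : curveB c d b z = 0) (h' : discB c d b z.im = 0) :
    z ∈ exceptionalSet c d a₁ a₂ b₁ b₂ :=
  Or.inr (mem_biUnion (Or.inl rfl : a₁.toReal ∈ ({a₁.toReal, a₂.toReal} : Set ℝ))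
    (mem_biUnion hb (Or.inr ⟨hb0, h, h'⟩)))

/-- `f` is a local equation of the boundary at `g`: near `g`, the set `F` is given by `0 ≤ f` and
the set `G` by `f = 0`, and `f` is regular at `g`, in the direction `v`. -/
def IsLocalEquation (F G : Set Sphere) (f : ℂ → ℝ) (g v : ℂ) : Prop :=
  IsRegularZero f g v ∧
    ∀ᶠ w : ℂ in 𝓝 g, ((w : Sphere) ∈ F ↔ 0 ≤ f w) ∧ ((w : Sphere) ∈ G ↔ f w = 0)

theorem IsRegularZero.isLocalEquation {F G : Set Sphere} {Q h : ℂ → ℝ} {v : ℂ} (s : ℝ)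
    (hs : s ≠ 0) (hQ : IsRegularZero Q g v) (hD : den c d g ≠ 0)
    (hQh : ∀ w, den c d w ≠ 0 → Q w = h w * den c d w)
    (hev : ∀ᶠ w : ℂ in 𝓝 g, ((w : Sphere) ∈ F ↔ 0 ≤ s * h w) ∧ ((w : Sphere) ∈ G ↔ h w = 0)) :
    IsLocalEquation F G (fun w => Q w * (s * den c d w)) g v := by
  refine ⟨hQ.mul (contDiff_const.mul contDiff_den) (mul_ne_zero hs hD), ?_⟩
  filter_upwards [hev, continuous_den.continuousAt.eventually_ne hD] with w hw hwD
  have h1 : Q w * (s * den c d w) = s * h w * den c d w ^ 2 := by rw [hQh w hwD]; ring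
  have h2 : 0 < den c d w ^ 2 := by positivity
  rw [h1, hw.1, hw.2]
  refine ⟨(mul_nonneg_iff_of_pos_right h2).symm, ?_⟩
  rw [mul_eq_zero, or_iff_left h2.ne', mul_eq_zero, or_iff_right hs]

/-- At its non-exceptional points, `G` has a local equation, which is regular in the horizontal
direction except on two horizontal lines. -/
theorem exists_isLocalEquation (hd : 0 < d) (ha : a₁ < a₂) (hb : b₁ < b₂)
    (hg : (g : Sphere) ∈ offAxisClosure c d (frontier (rect a₁ a₂ b₁ b₂)))
    (hgE : g ∉ exceptionalSet c d a₁ a₂ b₁ b₂) :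
    ∃ f v, IsLocalEquation (offAxisClosure c d (rect a₁ a₂ b₁ b₂))
      (offAxisClosure c d (frontier (rect a₁ a₂ b₁ b₂))) f g v ∧
      (g.im ≠ 0 → g.im ≠ -d / 2 → v = 1) := by
  have hre : g.re ≠ 0 := fun h => hgE (Or.inl (Or.inl ⟨h, hg⟩))
  have hR : res c d g ≠ 0 := fun h => hgE (Or.inl (Or.inr h))
  obtain ⟨hD, hx⟩ := (coe_mem_closure_frontier_iff hd hre hR).1 hg
  obtain ⟨⟨⟨hα₁, hα₂⟩, hβ₁, hβ₂⟩, hside⟩ := (mk_mem_frontier_rect_iff ha hb).1 hx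
  have hp := p_eq_zero_of_den_ne_zero hre hD
  have hcont := continuousAt_params hD
  have hcα : ContinuousAt (fun w => (alphaOf c d w : EReal)) g := hcont.fst
  have hcβ : ContinuousAt (fun w => betaOf c d w) g := hcont.snd
  have hev : ∀ᶠ w : ℂ in 𝓝 g, w.re ≠ 0 ∧ res c d w ≠ 0 ∧ den c d w ≠ 0 :=
    (Complex.continuous_re.continuousAt.eventually_ne hre).and
      ((continuous_res.continuousAt.eventually_ne hR).and
        (continuous_den.continuousAt.eventually_ne hD))
  simp only at hα₁ hα₂ hβ₁ hβ₂
  -- the two sides of constant `α`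
  have hA : ∀ a : ℝ, a = a₁.toReal ∨ a = a₂.toReal → alphaOf c d g = a →
      (∃ v, IsRegularZero (curveA c d a) g v ∧ (g.im ≠ -d / 2 → v = 1)) ∧
        b₁ < betaOf c d g ∧ betaOf c d g < b₂ := by
    intro a haa hag
    have hcA : curveA c d a g = 0 := by
      rw [curveA_of_den_ne_zero hD, hag, sub_self, zero_mul]
    rw [hag] at hp
    refine ⟨exists_isRegularZero_curveA hre hcA fun ha0 h =>
      hgE (mem_exceptionalSet_of_discA haa ha0 hcA h), lt_of_le_of_ne hβ₁ fun h => ?_,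
      lt_of_le_of_ne hβ₂ fun h => ?_⟩
    · exact hgE (mem_exceptionalSet_of_corner haa (Or.inl h.symm) hp)
    · exact hgE (mem_exceptionalSet_of_corner haa (Or.inr h) hp)
  -- the two sides of constant `β`
  have hB : ∀ b : ℝ, b = b₁ ∨ b = b₂ → betaOf c d g = b →
      (∃ v, IsRegularZero (curveB c d b) g v ∧ (g.im ≠ 0 → v = 1)) ∧
        a₁ < alphaOf c d g ∧ alphaOf c d g < a₂ := by
    intro b hbb hbg
    have hcB : curveB c d b g = 0 := by
      rw [curveB_of_den_ne_zero hD, hbg, sub_self, zero_mul]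
    rw [hbg] at hp
    refine ⟨exists_isRegularZero_curveB hre hR hcB fun hb0 h =>
      hgE (mem_exceptionalSet_of_discB hbb hb0 hcB h), lt_of_le_of_ne hα₁ fun h => ?_,
      lt_of_le_of_ne hα₂ fun h => ?_⟩
    · exact hgE (mem_exceptionalSet_of_corner (Or.inl (by rw [h, EReal.toReal_coe])) hbb hp)
    · exact hgE (mem_exceptionalSet_of_corner (Or.inr (by rw [← h, EReal.toReal_coe])) hbb hp)
  have hF : ∀ w : ℂ, w.re ≠ 0 → res c d w ≠ 0 → den c d w ≠ 0 →
      ((w : Sphere) ∈ offAxisClosure c d (rect a₁ a₂ b₁ b₂) ↔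
        (a₁ ≤ alphaOf c d w ∧ alphaOf c d w ≤ a₂) ∧ b₁ ≤ betaOf c d w ∧ betaOf c d w ≤ b₂) :=
    fun w h1 h2 h3 => (coe_mem_closure_rect_iff hd h1 h2).trans (and_iff_right h3)
  have hG : ∀ w : ℂ, w.re ≠ 0 → res c d w ≠ 0 → den c d w ≠ 0 →
      ((w : Sphere) ∈ offAxisClosure c d (frontier (rect a₁ a₂ b₁ b₂)) ↔
        ((a₁ ≤ alphaOf c d w ∧ alphaOf c d w ≤ a₂) ∧ b₁ ≤ betaOf c d w ∧ betaOf c d w ≤ b₂) ∧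
        ((alphaOf c d w : EReal) = a₁ ∨ (alphaOf c d w : EReal) = a₂ ∨
          betaOf c d w = b₁ ∨ betaOf c d w = b₂)) :=
    fun w h1 h2 h3 => (coe_mem_closure_frontier_iff hd h1 h2).trans
      ((and_iff_right h3).trans (mk_mem_frontier_rect_iff ha hb))
  have key : ∀ (Q h : ℂ → ℝ) (s : ℝ) (v : ℂ), s ≠ 0 → IsRegularZero Q g v →
      (∀ w, den c d w ≠ 0 → Q w = h w * den c d w) →
      (∀ᶠ w : ℂ in 𝓝 g,
        ((a₁ ≤ alphaOf c d w ∧ alphaOf c d w ≤ a₂) ∧ b₁ ≤ betaOf c d w ∧ betaOf c d w ≤ b₂ ↔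
          0 ≤ s * h w) ∧
        ((alphaOf c d w : EReal) = a₁ ∨ (alphaOf c d w : EReal) = a₂ ∨
          betaOf c d w = b₁ ∨ betaOf c d w = b₂ ↔ h w = 0)) →
      IsLocalEquation (offAxisClosure c d (rect a₁ a₂ b₁ b₂))
        (offAxisClosure c d (frontier (rect a₁ a₂ b₁ b₂)))
        (fun w => Q w * (s * den c d w)) g v := by
    intro Q h s v hs hQ hQh hw
    refine hQ.isLocalEquation s hs hD hQh ?_
    filter_upwards [hev, hw] with w ⟨hw1, hw2, hw3⟩ ⟨hw4, hw5⟩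
    rw [hF w hw1 hw2 hw3, hG w hw1 hw2 hw3, hw4, hw5]
    exact ⟨Iff.rfl, and_iff_right_of_imp fun h0 => by rw [h0, mul_zero]⟩
  rcases hside with h | h | h | h
  · obtain ⟨a, hag⟩ : ∃ a, alphaOf c d g = a := ⟨_, rfl⟩
    rw [hag] at h
    subst h
    obtain ⟨⟨v, hreg, hv⟩, h1, h2⟩ := hA a (Or.inl (EReal.toReal_coe a).symm) hag
    have hlt : (alphaOf c d g : EReal) < a₂ := by rwa [hag]
    refine ⟨_, v, key _ (fun w => alphaOf c d w - a) 1 v one_ne_zero hreg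
      (fun w hw => curveA_of_den_ne_zero hw) ?_, fun _ => hv⟩
    filter_upwards [hcα.eventually (gt_mem_nhds hlt), hcβ.eventually (lt_mem_nhds h1),
      hcβ.eventually (gt_mem_nhds h2)] with w h4 h5 h6
    simp [h4.le, h4.ne, h5.le, h5.ne', h6.le, h6.ne, sub_eq_zero]
  · obtain ⟨a, hag⟩ : ∃ a, alphaOf c d g = a := ⟨_, rfl⟩
    rw [hag] at h
    subst h
    obtain ⟨⟨v, hreg, hv⟩, h1, h2⟩ := hA a (Or.inr (EReal.toReal_coe a).symm) hag
    have hlt : a₁ < (alphaOf c d g : EReal) := by rwa [hag]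
    refine ⟨_, v, key _ (fun w => alphaOf c d w - a) (-1) v (by norm_num) hreg
      (fun w hw => curveA_of_den_ne_zero hw) ?_, fun _ => hv⟩
    filter_upwards [hcα.eventually (lt_mem_nhds hlt), hcβ.eventually (lt_mem_nhds h1),
      hcβ.eventually (gt_mem_nhds h2)] with w h4 h5 h6
    simp [h4.le, h4.ne', h5.le, h5.ne', h6.le, h6.ne, sub_eq_zero]
  · obtain ⟨⟨v, hreg, hv⟩, h1, h2⟩ := hB b₁ (Or.inl rfl) h
    have hlt : betaOf c d g < b₂ := by rwa [h]
    refine ⟨_, v, key _ (fun w => betaOf c d w - b₁) 1 v one_ne_zero hreg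
      (fun w hw => curveB_of_den_ne_zero hw) ?_, fun hv0 _ => hv hv0⟩
    filter_upwards [hcα.eventually (lt_mem_nhds h1), hcα.eventually (gt_mem_nhds h2),
      hcβ.eventually (gt_mem_nhds hlt)] with w h4 h5 h6
    simp [h4.le, h4.ne', h5.le, h5.ne, h6.le, h6.ne, sub_eq_zero]
  · obtain ⟨⟨v, hreg, hv⟩, h1, h2⟩ := hB b₂ (Or.inr rfl) h
    have hlt : b₁ < betaOf c d g := by rwa [h]
    refine ⟨_, v, key _ (fun w => betaOf c d w - b₂) (-1) v (by norm_num) hreg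
      (fun w hw => curveB_of_den_ne_zero hw) ?_, fun hv0 _ => hv hv0⟩
    filter_upwards [hcα.eventually (lt_mem_nhds h1), hcα.eventually (gt_mem_nhds h2),
      hcβ.eventually (lt_mem_nhds hlt)] with w h4 h5 h6
    simp [h4.le, h4.ne', h5.le, h5.ne, h6.le, h6.ne', sub_eq_zero]

/-- The local picture at a point with a local equation: connected pieces on both sides. -/
theorem IsLocalEquation.exists_pieces {F G : Set Sphere} {f : ℂ → ℝ} {v : ℂ}
    (hf : IsLocalEquation F G f g v) :
    ∃ U : Set ℂ, IsOpen U ∧ g ∈ U ∧ IsPreconnected (U ∩ {z | 0 < f z}) ∧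
      IsPreconnected (U ∩ {z | f z < 0}) ∧
      U ∩ {z | f z = 0} ⊆ closure (U ∩ {z | 0 < f z}) ∧
      U ∩ {z | f z = 0} ⊆ closure (U ∩ {z | f z < 0}) ∧
      (∃ γ : unitInterval → ℂ, Continuous γ ∧ Function.Injective γ ∧
        range γ ⊆ U ∩ {z | f z = 0}) ∧
      ∀ w ∈ U, ((w : Sphere) ∈ F ↔ 0 ≤ f w) ∧ ((w : Sphere) ∈ G ↔ f w = 0) := by
  obtain ⟨⟨h1, h2, h3⟩, hev⟩ := hf
  have hne : fderiv ℝ f g ≠ 0 := fun h => h3 (by rw [h]; rfl)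
  obtain ⟨U, hUN, hU, hgU, h4, h5, h6, h7, h8⟩ :=
    exists_nhds_of_regular (h1.contDiffAt.hasStrictFDerivAt one_ne_zero) hne h2 hev
  exact ⟨U, hU, hgU, h4, h5, h6, h7, h8, fun w hw => hUN hw⟩

theorem IsLocalEquation.isTwoSided {F G : Set Sphere} {f : ℂ → ℝ} {v : ℂ}
    (hf : IsLocalEquation F G f g v) : IsTwoSided G (F \ G) Fᶜ (g : Sphere) := by
  obtain ⟨U, hU, hgU, h4, h5, h6, h7, ⟨γ, hγ1, hγ2, hγ3⟩, h9⟩ := hf.exists_pieces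
  have hcoe := OnePoint.continuous_coe (X := ℂ)
  refine ⟨((↑) : ℂ → Sphere) '' U, ((↑) : ℂ → Sphere) '' (U ∩ {z | 0 < f z}),
    ((↑) : ℂ → Sphere) '' (U ∩ {z | f z < 0}), OnePoint.isOpen_image_coe.2 hU,
    mem_image_of_mem _ hgU, h4.image _ hcoe.continuousOn, h5.image _ hcoe.continuousOn,
    ?_, ?_, ?_, ?_, ?_, ?_⟩
  · rintro _ ⟨w, ⟨hwU, hw : 0 < f w⟩, rfl⟩
    exact ⟨(h9 w hwU).1.2 hw.le, fun h => hw.ne' ((h9 w hwU).2.1 h)⟩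
  · rintro _ ⟨w, ⟨hwU, hw : f w < 0⟩, rfl⟩ h
    exact absurd ((h9 w hwU).1.1 h) (not_le.2 hw)
  · rintro _ ⟨⟨w, hwU, rfl⟩, hwG⟩
    rcases lt_trichotomy (f w) 0 with h | h | h
    · exact Or.inr ⟨w, ⟨hwU, h⟩, rfl⟩
    · exact absurd ((h9 w hwU).2.2 h) hwG
    · exact Or.inl ⟨w, ⟨hwU, h⟩, rfl⟩
  · rintro _ ⟨⟨w, hwU, rfl⟩, hwG⟩
    exact image_closure_subset_closure_image hcoe
      (mem_image_of_mem _ (h6 ⟨hwU, (h9 w hwU).2.1 hwG⟩))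
  · rintro _ ⟨⟨w, hwU, rfl⟩, hwG⟩
    exact image_closure_subset_closure_image hcoe
      (mem_image_of_mem _ (h7 ⟨hwU, (h9 w hwU).2.1 hwG⟩))
  · refine ⟨fun t => (γ t : Sphere), hcoe.comp hγ1, OnePoint.coe_injective.comp hγ2, ?_⟩
    rintro _ ⟨t, rfl⟩
    have := hγ3 (mem_range_self t)
    exact ⟨mem_image_of_mem _ this.1, (h9 _ this.1).2.2 this.2⟩

theorem isColoring_rect (hc : 0 ≤ c) (hd : 0 < d) (ha : a₁ < a₂) (hb : b₁ < b₂) :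
    IsColoring (offAxisClosure c d (frontier (rect a₁ a₂ b₁ b₂)))
      (offAxisClosure c d (rect a₁ a₂ b₁ b₂) \
        offAxisClosure c d (frontier (rect a₁ a₂ b₁ b₂)))
      (offAxisClosure c d (rect a₁ a₂ b₁ b₂))ᶜ
      (insert OnePoint.infty (((↑) : ℂ → Sphere) '' exceptionalSet c d a₁ a₂ b₁ b₂)) where
  isClosed := isClosed_offAxisClosure
  isOpen_left := isOpen_closure_rect_diff hc hd ha hb
  isOpen_right := isClosed_offAxisClosure.isOpen_compl
  disjoint := disjoint_compl_right.mono_left sdiff_subset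
  union_eq := by
    have h := offAxisClosure_mono (c := c) (d := d)
      (frontier_rect_subset (a₁ := a₁) (a₂ := a₂) (b₁ := b₁) (b₂ := b₂))
    ext ω
    simp only [mem_union, Set.mem_sdiff, mem_compl_iff]
    constructor
    · rintro (h1 | h1)
      · exact h1.2
      · exact fun h2 => h1 (h h2)
    · intro h1
      by_cases h2 : ω ∈ offAxisClosure c d (rect a₁ a₂ b₁ b₂)
      · exact Or.inl ⟨h2, h1⟩
      · exact Or.inr h2
  finite := ((finite_exceptionalSet hd ha hb).image _).insert _
  isTwoSided := by
    intro ω hω hωZ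
    induction ω using OnePoint.rec with
    | infty => exact absurd (mem_insert _ _) hωZ
    | coe g =>
      have hgE : g ∉ exceptionalSet c d a₁ a₂ b₁ b₂ := fun h =>
        hωZ (mem_insert_of_mem _ (mem_image_of_mem _ h))
      obtain ⟨f, v, hf, -⟩ := exists_isLocalEquation hd ha hb hω hgE
      exact hf.isTwoSided

end LocalStructure

/-! ### Finiteness of the number of components -/

section Gaps

/-- A family is finite if each of its members can be assigned a real number off a finite set in
such a way that only finitely many members have their number in any given gap of that set. -/
theorem finite_of_gaps {ι : Type*} {𝒞 : Set ι} {S : Set ℝ} (hS : S.Finite) (h : ι → ℝ)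
    (hS' : ∀ C ∈ 𝒞, h C ∉ S)
    (hfib : ∀ C₀ ∈ 𝒞, {C ∈ 𝒞 | uIcc (h C₀) (h C) ⊆ Sᶜ}.Finite) : 𝒞.Finite := by
  refine Finite.of_finite_fibers (fun C => {u ∈ S | u < h C}) ?_ ?_
  · refine hS.powerset.subset ?_
    rintro _ ⟨C, -, rfl⟩
    exact sep_subset _ _
  · rintro _ ⟨C₀, hC₀, rfl⟩
    refine (hfib C₀ hC₀).subset ?_
    rintro C ⟨hC, hCC⟩
    refine ⟨hC, fun u hu huS => ?_⟩
    have hiff : u < h C ↔ u < h C₀ := by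
      have : u ∈ {u ∈ S | u < h C} ↔ u ∈ {u ∈ S | u < h C₀} := by
        rw [show {u ∈ S | u < h C} = {u ∈ S | u < h C₀} from hCC]
      simpa [huS] using this
    have h1 : u ≠ h C := fun h' => hS' C hC (h' ▸ huS)
    have h2 : u ≠ h C₀ := fun h' => hS' C₀ hC₀ (h' ▸ huS)
    rcases mem_uIcc.1 hu with ⟨h3, h4⟩ | ⟨h3, h4⟩
    · exact absurd (hiff.1 (lt_of_le_of_ne h4 h1)) (not_lt.2 h3)
    · exact absurd (hiff.2 (lt_of_le_of_ne h4 h2)) (not_lt.2 h3)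

end Gaps

section Finiteness

variable {c d : ℝ} {a₁ a₂ : EReal} {b₁ b₂ : ℝ} {y : ℝ}

theorem eventually_quadratic_ne_zero {A B C : ℝ → ℝ} (hA : Continuous A) (hB : Continuous B)
    (hC : Continuous C) (hy : A y ≠ 0) :
    ∀ᶠ q : ℝ × ℝ in 𝓝 y ×ˢ atTop, A q.1 * q.2 ^ 2 + B q.1 * q.2 + C q.1 ≠ 0 := by
  have hfst : ∀ {f : ℝ → ℝ}, Continuous f →
      Tendsto (fun q : ℝ × ℝ => f q.1) (𝓝 y ×ˢ atTop) (𝓝 (f y)) := fun hf =>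
    (hf.tendsto y).comp tendsto_fst
  have hinv : Tendsto (fun q : ℝ × ℝ => q.2⁻¹) (𝓝 y ×ˢ atTop) (𝓝 0) :=
    tendsto_inv_atTop_zero.comp tendsto_snd
  have hlim := ((hfst hA).add ((hfst hB).mul hinv)).add ((hfst hC).mul (hinv.pow 2))
  have hpos : ∀ᶠ q : ℝ × ℝ in 𝓝 y ×ˢ atTop, 0 < q.2 :=
    (eventually_gt_atTop (0 : ℝ)).prod_inr (𝓝 y)
  filter_upwards [hlim.eventually_ne (show A y + B y * 0 + C y * 0 ^ 2 ≠ 0 by simpa using hy),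
    hpos] with q h1 h2 h3
  apply h1
  have : A q.1 + B q.1 * q.2⁻¹ + C q.1 * q.2⁻¹ ^ 2 =
      (A q.1 * q.2 ^ 2 + B q.1 * q.2 + C q.1) / q.2 ^ 2 := by field_simp
  rw [this, h3, zero_div]

/-- Near a horizontal line on which the leading coefficients of the curves do not vanish, the curves
stay away from infinity. -/
theorem exists_notMem_of_far (ha : a₁ < a₂) (hb : b₁ < b₂) (hy0 : y ≠ 0) (hyd : y ≠ -d / 2) :
    ∃ δ > 0, ∃ M : ℝ, ∀ z : ℂ, |z.im - y| < δ → M < |z.re| →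
      (z : Sphere) ∉ offAxisClosure c d (frontier (rect a₁ a₂ b₁ b₂)) := by
  have hyd' : d + 2 * y ≠ 0 := fun h => hyd (by linarith)
  have hA : ∀ a : ℝ, ∀ᶠ q : ℝ × ℝ in 𝓝 y ×ˢ atTop,
      (d + 2 * q.1) * q.2 ^ 2 + -(a * d) * q.2 + -(2 * a * c * q.1) ≠ 0 := fun a =>
    eventually_quadratic_ne_zero (A := fun y => d + 2 * y) (B := fun _ => -(a * d))
      (C := fun y => -(2 * a * c * y)) (by fun_prop) (by fun_prop) (by fun_prop) hyd'
  have hB : ∀ b : ℝ, ∀ᶠ q : ℝ × ℝ in 𝓝 y ×ˢ atTop,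
      -2 * q.1 * q.2 ^ 2 + linB c d b q.1 * q.2 +
        -(2 * c * q.1 * (c + 2 * q.1 * (d + 2 * q.1) + b)) ≠ 0 := fun b =>
    eventually_quadratic_ne_zero (A := fun y => -2 * y) (B := fun y => linB c d b y)
      (C := fun y => -(2 * c * y * (c + 2 * y * (d + 2 * y) + b))) (by fun_prop)
      (by unfold linB; fun_prop) (by fun_prop) (by simpa using hy0)
  have hall := ((hA a₁.toReal).and (hA a₂.toReal)).and ((hB b₁).and (hB b₂))
  obtain ⟨⟨δ, M⟩, ⟨hδ, -⟩, hq⟩ := (Metric.nhds_basis_ball.prod atTop_basis).eventually_iff.1 hall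
  refine ⟨δ, hδ, max 1 M, fun z hz1 hz2 hzG => ?_⟩
  have h1 : 1 < |z.re| := (le_max_left _ _).trans_lt hz2
  have h2 : M < |z.re| := (le_max_right _ _).trans_lt hz2
  have h3 : M ≤ sqMod z := by
    have h4 : |z.re| ^ 2 = z.re ^ 2 := sq_abs _
    unfold sqMod
    nlinarith [sq_nonneg z.im]
  obtain ⟨⟨h5, h6⟩, h7, h8⟩ := @hq (z.im, sqMod z) ⟨by
    rw [Metric.mem_ball, Real.dist_eq]; exact hz1, h3⟩
  have hcurves := mem_curves_of_mem_closure_frontier ha hb hzG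
  rw [curveA_eq, curveA_eq, curveB_eq, curveB_eq] at hcurves
  tauto

theorem finite_line_inter (ha : a₁ < a₂) (hb : b₁ < b₂) (hy0 : y ≠ 0) (hyd : y ≠ -d / 2) :
    {x : ℝ | ((⟨x, y⟩ : ℂ) : Sphere) ∈
      offAxisClosure c d (frontier (rect a₁ a₂ b₁ b₂))}.Finite := by
  have hyd' : d + 2 * y ≠ 0 := fun h => hyd (by linarith)
  have hA : ∀ a : ℝ, {x : ℝ | curveA c d a ⟨x, y⟩ = 0}.Finite := fun a => by
    refine (finite_setOf_quadratic_sq (A := d + 2 * y) (B := -(a * d))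
      (C := -(2 * a * c * y)) (s := y ^ 2) (Or.inl hyd')).subset fun x hx => ?_
    rw [mem_ofPred_eq, curveA_eq] at hx
    exact hx
  have hB : ∀ b : ℝ, {x : ℝ | curveB c d b ⟨x, y⟩ = 0}.Finite := fun b => by
    refine (finite_setOf_quadratic_sq (A := -2 * y) (B := linB c d b y)
      (C := -(2 * c * y * (c + 2 * y * (d + 2 * y) + b))) (s := y ^ 2)
      (Or.inl (by simpa using hy0))).subset fun x hx => ?_
    rw [mem_ofPred_eq, curveB_eq] at hx
    exact hx
  exact (((hA a₁.toReal).union (hA a₂.toReal)).union ((hB b₁).union (hB b₂))).subset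
    fun x hx => mem_curves_of_mem_closure_frontier ha hb hx

theorem continuous_mk {f g : ℝ → ℝ} (hf : Continuous f) (hg : Continuous g) :
    Continuous fun t => (⟨f t, g t⟩ : ℂ) :=
  Complex.equivRealProdCLM.symm.continuous.comp (hf.prodMk hg)

/-- The set of imaginary parts of the points of `C`. -/
def heights (C : Set Sphere) : Set ℝ := {y | ∃ x : ℝ, ((⟨x, y⟩ : ℂ) : Sphere) ∈ C}

theorem heights_eq_image (C : Set Sphere) :
    heights C = Complex.im '' (((↑) : ℂ → Sphere) ⁻¹' C) := by
  ext y
  constructor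
  · rintro ⟨x, hx⟩
    exact ⟨⟨x, y⟩, hx, rfl⟩
  · rintro ⟨z, hz, rfl⟩
    exact ⟨z.re, hz⟩

theorem isOpen_heights {C : Set Sphere} (hC : IsOpen C) : IsOpen (heights C) := by
  rw [heights_eq_image]
  exact Complex.isOpenMap_im _ (hC.preimage OnePoint.continuous_coe)

theorem heights_nonempty {C : Set Sphere} (hC : IsOpen C) (hne : C.Nonempty) :
    (heights C).Nonempty := by
  obtain ⟨_, hz, z, rfl⟩ := OnePoint.denseRange_coe.inter_open_nonempty C hC hne
  exact ⟨z.im, z.re, hz⟩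

/-- The heights at which a component can appear or disappear. -/
def exceptionalHeights (c d : ℝ) (a₁ a₂ : EReal) (b₁ b₂ : ℝ) : Set ℝ :=
  {0, -d / 2} ∪ Complex.im '' exceptionalSet c d a₁ a₂ b₁ b₂

theorem finite_exceptionalHeights (hd : 0 < d) (ha : a₁ < a₂) (hb : b₁ < b₂) :
    (exceptionalHeights c d a₁ a₂ b₁ b₂).Finite :=
  (toFinite _).union ((finite_exceptionalSet hd ha hb).image _)

/-- At a non-exceptional height a component cannot stop: `G` is transversal to the horizontal line,
so both pieces next to a boundary point extend over that height. -/
theorem mem_heights_of_mem_closure (hd : 0 < d) (ha : a₁ < a₂) (hb : b₁ < b₂) {C : Set Sphere}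
    (hC : IsComponent (offAxisClosure c d (frontier (rect a₁ a₂ b₁ b₂)))ᶜ C)
    (hy : y ∉ exceptionalHeights c d a₁ a₂ b₁ b₂) (hyC : y ∈ closure (heights C)) :
    y ∈ heights C := by
  set G := offAxisClosure c d (frontier (rect a₁ a₂ b₁ b₂)) with hGdef
  have hy0 : y ≠ 0 := fun h => hy (Or.inl (Or.inl h))
  have hyd : y ≠ -d / 2 := fun h => hy (Or.inl (Or.inr h))
  have hGo : IsOpen Gᶜ := isClosed_offAxisClosure.isOpen_compl
  have hcoe := OnePoint.continuous_coe (X := ℂ)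
  obtain ⟨δ, hδ, M, hfar⟩ := exists_notMem_of_far (c := c) ha hb hy0 hyd
  by_cases hbig : ∃ z : ℂ, (z : Sphere) ∈ C ∧ |z.im - y| < δ ∧ M < |z.re|
  · -- the vertical segment from `z` to height `y` avoids `G`
    obtain ⟨z, hzC, hz1, hz2⟩ := hbig
    have hcont : Continuous fun t : ℝ => ((⟨z.re, t⟩ : ℂ) : Sphere) := by
      exact hcoe.comp (continuous_mk continuous_const continuous_id)
    have hsub := hC.superset (isPreconnected_uIcc.image _ hcont.continuousOn)
      (A := (fun t : ℝ => ((⟨z.re, t⟩ : ℂ) : Sphere)) '' uIcc z.im y) ?_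
      ⟨z, ⟨z.im, left_mem_uIcc, rfl⟩, hzC⟩
    · exact ⟨z.re, hsub ⟨y, right_mem_uIcc, rfl⟩⟩
    · rintro _ ⟨t, ht, rfl⟩
      refine hfar _ ?_ hz2
      have h1 := abs_sub_left_of_mem_uIcc ht
      have h2 : |t - y| ≤ |z.im - y| := by
        have := abs_sub_right_of_mem_uIcc ht
        rw [abs_sub_comm]
        rwa [abs_sub_comm z.im y]
      exact h2.trans_lt hz1
  · push Not at hbig
    -- the part of `C` near height `y` is bounded, so `y` is the height of a point of its closure
    obtain ⟨z, hzcl, hzy⟩ : ∃ z : ℂ, z ∈ closure (((↑) : ℂ → Sphere) ⁻¹' C) ∧ z.im = y := by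
      set K : Set ℂ := closure (((↑) : ℂ → Sphere) ⁻¹' C) ∩
        (Icc (-M) M ×ℂ Icc (y - δ / 2) (y + δ / 2)) with hK
      have hKc : IsCompact K :=
        (isCompact_Icc.reProdIm isCompact_Icc).inter_left isClosed_closure
      have hyK : y ∈ closure (Complex.im '' K) := by
        rw [mem_closure_iff_nhds] at hyC ⊢
        intro t ht
        obtain ⟨u, ⟨hut, hu⟩, x, hx⟩ :=
          hyC (t ∩ Metric.ball y (δ / 2)) (inter_mem ht (Metric.ball_mem_nhds y (half_pos hδ)))
        rw [Metric.mem_ball, Real.dist_eq] at hu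
        have h1 := hbig ⟨x, u⟩ hx (by simpa using hu.trans (half_lt_self hδ))
        refine ⟨u, hut, ⟨x, u⟩, ⟨subset_closure hx, ?_⟩, rfl⟩
        rw [abs_lt] at hu
        exact ⟨abs_le.1 h1, by constructor <;> simp only <;> linarith⟩
      rw [(hKc.image Complex.continuous_im).isClosed.closure_eq] at hyK
      obtain ⟨z, hz, hzy⟩ := hyK
      exact ⟨z, hz.1, hzy⟩
    have hzcl' : (z : Sphere) ∈ closure C :=
      closure_mono (image_preimage_subset _ _)
        (image_closure_subset_closure_image hcoe (mem_image_of_mem _ hzcl))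
    by_cases hzG : (z : Sphere) ∈ G
    swap
    · have := hC.isComponentUnion.mem_of_mem_closure hGo hzcl' hzG
      exact ⟨z.re, by rw [← hzy]; exact this⟩
    have hzE : z ∉ exceptionalSet c d a₁ a₂ b₁ b₂ := fun h => hy (Or.inr ⟨z, h, hzy⟩)
    obtain ⟨f, v, hf, hv⟩ := exists_isLocalEquation hd ha hb hzG hzE
    have hv1 := hv (hzy ▸ hy0) (hzy ▸ hyd)
    obtain ⟨U, hU, hzU, h4, h5, -, -, -, h9⟩ := hf.exists_pieces
    obtain ⟨⟨t, htU, ht⟩, s, hsU, hs⟩ := hf.1.exists_pos_neg (hU.mem_nhds hzU)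
    obtain ⟨w, hwU, hwC⟩ := mem_closure_iff.1 hzcl U hU hzU
    have hpiece : ∀ T : Set ℂ, IsPreconnected (U ∩ T) → (∀ u ∈ T, f u ≠ 0) → w ∈ T →
        ∀ t : ℝ, z + t * v ∈ U ∩ T → y ∈ heights C := by
      intro T hT hT0 hwT t ht
      have hsub := hC.superset (hT.image _ hcoe.continuousOn) (by
        rintro _ ⟨u, ⟨huU, huT⟩, rfl⟩ huG
        exact hT0 u huT ((h9 u huU).2.1 huG)) ⟨w, mem_image_of_mem _ ⟨hwU, hwT⟩, hwC⟩
      have hmem := hsub (mem_image_of_mem _ ht)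
      refine ⟨(z + t * v).re, ?_⟩
      have him : (z + t * v).im = y := by rw [hv1, ← hzy]; simp
      rw [← him]
      exact hmem
    have hfw : f w ≠ 0 := fun h => hC.subset hwC ((h9 w hwU).2.2 h)
    rcases lt_or_gt_of_ne hfw with hlt | hgt
    · exact hpiece {u | f u < 0} h5 (fun u hu => ne_of_lt hu) hlt s ⟨hsU, hs⟩
    · exact hpiece {u | 0 < f u} h4 (fun u hu => ne_of_gt hu) hgt t ⟨htU, ht⟩

/-- Only finitely many components meet a given non-exceptional horizontal line. -/
theorem finite_components_at_height (ha : a₁ < a₂) (hb : b₁ < b₂)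
    (hy : y ∉ exceptionalHeights c d a₁ a₂ b₁ b₂) :
    {C | IsComponent (offAxisClosure c d (frontier (rect a₁ a₂ b₁ b₂)))ᶜ C ∧
      y ∈ heights C}.Finite := by
  have hy0 : y ≠ 0 := fun h => hy (Or.inl (Or.inl h))
  have hyd : y ≠ -d / 2 := fun h => hy (Or.inl (Or.inr h))
  have hex : ∀ C ∈ {C | IsComponent (offAxisClosure c d (frontier (rect a₁ a₂ b₁ b₂)))ᶜ C ∧
      y ∈ heights C}, ∃ x : ℝ, ((⟨x, y⟩ : ℂ) : Sphere) ∈ C := fun C hC => hC.2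
  choose! h hh using hex
  refine finite_of_gaps (finite_line_inter (c := c) ha hb hy0 hyd) h ?_ ?_
  · intro C hC hmem
    exact hC.1.subset (hh C hC) hmem
  · intro C₀ hC₀
    refine (finite_singleton C₀).subset ?_
    rintro C ⟨hC, hseg⟩
    have hcont : Continuous fun t : ℝ => ((⟨t, y⟩ : ℂ) : Sphere) := by
      exact OnePoint.continuous_coe.comp (continuous_mk continuous_id continuous_const)
    have hsub := hC.1.superset (isPreconnected_uIcc.image _ hcont.continuousOn)
      (A := (fun t : ℝ => ((⟨t, y⟩ : ℂ) : Sphere)) '' uIcc (h C₀) (h C)) ?_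
      ⟨_, ⟨h C, right_mem_uIcc, rfl⟩, hh C hC⟩
    · exact hC.1.eq_of_inter hC₀.1 ⟨_, hsub ⟨h C₀, left_mem_uIcc, rfl⟩, hh C₀ hC₀⟩
    · rintro _ ⟨t, ht, rfl⟩
      exact hseg ht

theorem finite_components (hd : 0 < d) (ha : a₁ < a₂) (hb : b₁ < b₂) :
    {C | IsComponent (offAxisClosure c d (frontier (rect a₁ a₂ b₁ b₂)))ᶜ C}.Finite := by
  have hY := finite_exceptionalHeights (c := c) hd ha hb
  have hGo : IsOpen (offAxisClosure c d (frontier (rect a₁ a₂ b₁ b₂)))ᶜ :=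
    isClosed_offAxisClosure.isOpen_compl
  have hex : ∀ C ∈ {C | IsComponent (offAxisClosure c d (frontier (rect a₁ a₂ b₁ b₂)))ᶜ C},
      ∃ y, y ∈ heights C ∧ y ∉ exceptionalHeights c d a₁ a₂ b₁ b₂ := by
    intro C hC
    have hCo := hC.isOpen hGo
    exact (hY.countable.dense_compl ℝ).inter_open_nonempty _ (isOpen_heights hCo)
      (heights_nonempty hCo hC.nonempty)
  choose! h hh hhY using hex
  refine finite_of_gaps hY h hhY fun C₀ hC₀ => ?_
  refine (finite_components_at_height (c := c) ha hb (hhY C₀ hC₀)).subset ?_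
  rintro C ⟨hC, hgap⟩
  refine ⟨hC, ?_⟩
  have hsub : uIcc (h C₀) (h C) ⊆ heights C := by
    refine isPreconnected_uIcc.subset_of_closure_inter_subset (isOpen_heights (hC.isOpen hGo))
      ⟨h C, right_mem_uIcc, hh C hC⟩ ?_
    rintro u ⟨hu, huI⟩
    exact mem_heights_of_mem_closure hd ha hb hC (hgap huI) hu
  exact hsub left_mem_uIcc

end Finiteness

section Conclusion

variable {c d : ℝ} {a₁ a₂ : EReal} {b₁ b₂ : ℝ}

/-- Far up in the upper half plane, `β` is very negative. -/
theorem im_le_of_mem_closure_rect (hc : 0 ≤ c) (hd : 0 < d) {z : ℂ}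
    (h : (z : Sphere) ∈ offAxisClosure c d (rect a₁ a₂ b₁ b₂)) : z.im ≤ |b₁| + 1 := by
  refine mem_of_mem_offAxisClosure (T := {z : ℂ | z.im ≤ |b₁| + 1})
    (isClosed_le Complex.continuous_im continuous_const) ?_ h
  intro w hw hwW
  by_contra! hlt
  have hlt' : |b₁| + 1 < w.im := by simpa using hlt
  have hy : 1 < w.im := by linarith [abs_nonneg b₁]
  have hy0 : 0 ≤ w.im := by linarith
  have hD : 0 < den c d w := by
    have := mul_pos hd (sqMod_pos hw)
    have : 0 ≤ 2 * c * w.im := by positivity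
    unfold den; linarith
  have hR : (d + 2 * w.im) * den c d w ≤ res c d w := by
    unfold res; linarith [sq_nonneg (c - sqMod w)]
  have hR0 : 0 < res c d w := lt_of_lt_of_le (by positivity) hR
  have hmem := ((coe_mem_W_iff hd hw hR0.ne').1 hwW).2.2.1
  simp only [betaOf] at hmem
  rw [le_div_iff₀ hD] at hmem
  have h1 : b₁ ≤ -2 * w.im * (d + 2 * w.im) := by
    refine le_of_mul_le_mul_right (hmem.trans ?_) hD
    have : 2 * w.im * ((d + 2 * w.im) * den c d w) ≤ 2 * w.im * res c d w := by gcongr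
    linarith
  have h2 : 0 ≤ w.im * d := by positivity
  nlinarith [neg_abs_le b₁]

theorem labelling_rect (hc : 0 ≤ c) (hd : 0 < d) (ha : a₁ < a₂) (hb : b₁ < b₂) :
    (∃! O₀ : Set Sphere,
      IsComponent (offAxisClosure c d (frontier (rect a₁ a₂ b₁ b₂)))ᶜ O₀ ∧
        HasLargeImagParts O₀) ∧
    ∀ O₀ : Set Sphere,
      IsComponent (offAxisClosure c d (frontier (rect a₁ a₂ b₁ b₂)))ᶜ O₀ →
      HasLargeImagParts O₀ →
      ∃ n : ℕ, StopsAt (offAxisClosure c d (frontier (rect a₁ a₂ b₁ b₂)))ᶜ O₀ n ∧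
        offAxisClosure c d (rect a₁ a₂ b₁ b₂) =
          (labels (offAxisClosure c d (frontier (rect a₁ a₂ b₁ b₂)))ᶜ O₀ n).1 ∪
            offAxisClosure c d (frontier (rect a₁ a₂ b₁ b₂)) := by
  have hcol := isColoring_rect hc hd ha hb
  have hGF : offAxisClosure c d (frontier (rect a₁ a₂ b₁ b₂)) ⊆
      offAxisClosure c d (rect a₁ a₂ b₁ b₂) := offAxisClosure_mono frontier_rect_subset
  set F := offAxisClosure c d (rect a₁ a₂ b₁ b₂) with hF
  set G := offAxisClosure c d (frontier (rect a₁ a₂ b₁ b₂)) with hG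
  set A : Set Sphere := ((↑) : ℂ → Sphere) '' {z : ℂ | |b₁| + 1 < z.im} with hA
  have hAF : A ⊆ Fᶜ := by
    rintro _ ⟨z, hz : |b₁| + 1 < z.im, rfl⟩ hzF
    exact absurd (im_le_of_mem_closure_rect hc hd hzF) (not_le.2 hz)
  have hAG : A ⊆ Gᶜ := hAF.trans (compl_subset_compl.2 hGF)
  have hAc : IsPreconnected A :=
    (convex_halfSpace_im_gt _).isPreconnected.image _ OnePoint.continuous_coe.continuousOn
  have hmeet : ∀ O₀, IsComponent Gᶜ O₀ → HasLargeImagParts O₀ → A ⊆ O₀ := by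
    intro O₀ hO hlarge
    obtain ⟨z, hz, hzO⟩ := hlarge (|b₁| + 1)
    exact hO.superset hAc hAG ⟨z, mem_image_of_mem _ hz, hzO⟩
  have hmemA : ∀ M : ℝ, ((⟨0, max M (|b₁| + 1) + 1⟩ : ℂ) : Sphere) ∈ A := fun M =>
    mem_image_of_mem _ (show |b₁| + 1 < max M (|b₁| + 1) + 1 by
      linarith [le_max_right M (|b₁| + 1)])
  refine ⟨?_, ?_⟩
  · obtain ⟨O₀, hO, hmem⟩ := exists_isComponent_of_mem (hAG (hmemA 0))
    have hAO : A ⊆ O₀ := hO.superset hAc hAG ⟨_, hmemA 0, hmem⟩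
    refine ⟨O₀, ⟨hO, fun M => ⟨_, ?_, hAO (hmemA M)⟩⟩, ?_⟩
    · exact lt_of_le_of_lt (le_max_left M (|b₁| + 1)) (lt_add_one _)
    · rintro C ⟨hC, hlarge⟩
      exact hC.eq_of_inter hO ⟨_, hmeet C hC hlarge (hmemA 0), hmem⟩
  · intro O₀ hO hlarge
    have hAO := hmeet O₀ hO hlarge
    have hOQ : O₀ ⊆ Fᶜ := (hcol.subset_or_subset hO).resolve_left fun h =>
      hAF (hmemA 0) (h (hAO (hmemA 0))).1
    obtain ⟨n, hn, hP⟩ := hcol.exists_stopsAt (finite_components hd ha hb) hO hOQ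
    refine ⟨n, hn, ?_⟩
    rw [hP, sdiff_union_of_subset hGF]

end Conclusion

/-! ### The numerical ranges -/

section NumericalRange

variable {H : Type*} [NormedAddCommGroup H] [InnerProductSpace ℂ H] {T : H →ₗ.[ℂ] H}

theorem mem_numRange_iff (hT : T.IsFormalAdjoint T) {a : ℝ} : a ∈ numRange T ↔
    ∃ u : T.domain, u ≠ 0 ∧
      (inner ℂ (u : H) (T u)).re - a * (inner ℂ (u : H) (u : H)).re = 0 := by
  have h1 : ∀ u : T.domain, (inner ℂ (u : H) (T u)).im = 0 := fun u => by
    rw [← Complex.conj_eq_iff_im, inner_conj_symm]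
    exact hT u u
  have h2 : ∀ u : T.domain, (inner ℂ (u : H) (u : H)).im = 0 := fun u => by
    rw [← Complex.conj_eq_iff_im, inner_conj_symm]
  refine exists_congr fun u => and_congr_right fun hu => ?_
  have hu' : inner ℂ (u : H) (u : H) ≠ 0 := by
    rw [Ne, inner_self_eq_zero]
    exact fun h => hu (Subtype.ext h)
  rw [eq_div_iff hu', Complex.ext_iff]
  simp only [Complex.re_ofReal_mul, Complex.im_ofReal_mul, h1, h2, mul_zero, and_true]
  rw [sub_eq_zero, eq_comm]

/-- The numerical range of a symmetric operator is an interval: along the segment between two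
vectors, the quadratic form of `T - t` changes sign. -/
theorem ordConnected_numRange (hT : T.IsFormalAdjoint T) : OrdConnected (numRange T) := by
  refine ⟨?_⟩
  rintro a ha b hb t ⟨hat, htb⟩
  rw [mem_numRange_iff hT] at ha hb ⊢
  obtain ⟨u, hu, hua⟩ := ha
  obtain ⟨v, hv, hvb⟩ := hb
  set h : T.domain → ℝ := fun w =>
    (inner ℂ (w : H) (T w)).re - t * (inner ℂ (w : H) (w : H)).re with hh
  have hsmul : ∀ (r : ℝ) (w : T.domain), h ((r : ℂ) • w) = r ^ 2 * h w := by
    intro r w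
    simp only [hh, LinearPMap.map_smul, Submodule.coe_smul, inner_smul_left, inner_smul_right,
      Complex.conj_ofReal, Complex.re_ofReal_mul]
    ring
  have hnonneg : ∀ w : T.domain, 0 ≤ (inner ℂ (w : H) (w : H)).re := fun w =>
    inner_self_nonneg (𝕜 := ℂ)
  have hu0 : h u ≤ 0 := by
    have := mul_le_mul_of_nonneg_right hat (hnonneg u)
    simp only [hh]; linarith
  have hv0 : 0 ≤ h v := by
    have := mul_le_mul_of_nonneg_right htb (hnonneg v)
    simp only [hh]; linarith
  have hcont : Continuous fun s : ℝ => h (((1 - s : ℝ) : ℂ) • u + (s : ℂ) • v) := by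
    simp only [hh, LinearPMap.map_add, LinearPMap.map_smul, Submodule.coe_add, Submodule.coe_smul]
    fun_prop
  obtain ⟨s, -, hs⟩ := intermediate_value_Icc (zero_le_one (α := ℝ)) hcont.continuousOn
    (show (0 : ℝ) ∈ Icc _ _ by simpa using ⟨hu0, hv0⟩)
  by_cases hw : ((1 - s : ℝ) : ℂ) • u + (s : ℂ) • v = 0
  swap
  · exact ⟨_, hw, hs⟩
  -- `u` and `v` are linearly dependent, and `h` vanishes on both
  have hs0 : s ≠ 0 := by
    rintro rfl
    exact hu (by simpa using hw)
  have h1 : h (((1 - s : ℝ) : ℂ) • u) = h ((s : ℂ) • v) := by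
    rw [eq_neg_of_add_eq_zero_left hw]
    have := hsmul (-1) ((s : ℂ) • v)
    simpa using this
  rw [hsmul, hsmul] at h1
  have h2 : s ^ 2 * h v = 0 := by
    refine le_antisymm ?_ (by positivity)
    rw [← h1]
    exact mul_nonpos_of_nonneg_of_nonpos (sq_nonneg _) hu0
  exact ⟨v, hv, (mul_eq_zero.1 h2).resolve_left (pow_ne_zero 2 hs0)⟩

theorem numRange_nonempty (h : ∃ u : T.domain, u ≠ 0) (hT : T.IsFormalAdjoint T) :
    (numRange T).Nonempty := by
  obtain ⟨u, hu⟩ := h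
  have hu' : (inner ℂ (u : H) (u : H)).re ≠ 0 := by
    intro h0
    have : inner ℂ (u : H) (u : H) = 0 := by
      refine Complex.ext h0 ?_
      exact Complex.conj_eq_iff_im.1 (inner_conj_symm (u : H) (u : H))
    rw [inner_self_eq_zero] at this
    exact hu (Subtype.ext this)
  refine ⟨(inner ℂ (u : H) (T u)).re / (inner ℂ (u : H) (u : H)).re,
    (mem_numRange_iff hT).2 ⟨u, hu, ?_⟩⟩
  rw [div_mul_cancel₀ _ hu', sub_self]

theorem abs_le_of_mem_numRangeBdd {B : H →L[ℂ] H} {b : ℝ} (hb : b ∈ numRangeBdd B) :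
    |b| ≤ ‖B‖ := by
  obtain ⟨u, hu, h⟩ := hb
  have h1 := congrArg norm h
  rw [Complex.norm_real, Real.norm_eq_abs, norm_div] at h1
  rw [h1]
  have hu0 : 0 < ‖(u : H)‖ := norm_pos_iff.2 fun h0 => hu (Subtype.ext h0)
  have h2 : ‖inner ℂ (u : H) (u : H)‖ = ‖(u : H)‖ * ‖(u : H)‖ := by
    rw [inner_self_eq_norm_sq_to_K]; simp [pow_two]
  rw [h2, div_le_iff₀ (mul_pos hu0 hu0)]
  calc ‖inner ℂ (u : H) (B u)‖ ≤ ‖(u : H)‖ * ‖B u‖ := norm_inner_le_norm _ _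
    _ ≤ ‖(u : H)‖ * (‖B‖ * ‖(u : H)‖) := by gcongr; exact B.le_opNorm _
    _ = _ := by ring

end NumericalRange

/-- The closure of a connected set, if compact, is the interval between two distinct points, unless
the set is a single point. -/
theorem exists_closure_eq_Icc {X : Type*} [ConditionallyCompleteLinearOrder X] [TopologicalSpace X]
    [OrderTopology X] {s : Set X} (hs : IsConnected s) (hc : IsCompact (closure s))
    (hne : ∀ x, s ≠ {x}) : ∃ x y, x < y ∧ closure s = Icc x y := by
  have h := eq_Icc_of_connected_compact hs.closure hc
  refine ⟨_, _, ?_, h⟩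
  obtain ⟨z, hz⟩ := hs.nonempty
  have hz' := subset_closure hz
  rw [h] at hz'
  refine lt_of_le_of_ne (hz'.1.trans hz'.2) fun heq => ?_
  rw [← heq, Icc_self] at h
  exact hne _ (((subset_closure.trans h.subset).antisymm fun x hx => by
    have h1 := h.subset (subset_closure hz)
    rw [mem_singleton_iff] at h1 hx
    rwa [hx, ← h1]))

theorem interior_singleton_coe (a : ℝ) : interior ({(a : EReal)} : Set EReal) = ∅ := by
  rw [eq_empty_iff_forall_notMem]
  intro x hx
  have hxa : x ∈ ({(a : EReal)} : Set EReal) := interior_subset hx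
  rw [mem_singleton_iff] at hxa
  subst hxa
  have h1 := continuous_coe_real_ereal.continuousAt.preimage_mem_nhds
    (mem_interior_iff_mem_nhds.1 hx)
  have h2 : (fun a : ℝ => (a : EReal)) ⁻¹' {(a : EReal)} = {a} := by
    ext y; simp
  rw [h2, ← mem_interior_iff_mem_nhds, interior_singleton] at h1
  exact h1

end RationalNumRange

theorem proposition2p19 {H : Type*} [NormedAddCommGroup H] [InnerProductSpace ℂ H]
    [CompleteSpace H] (A : H →ₗ.[ℂ] H) (hA : IsSelfAdjoint A)
    (B : H →L[ℂ] H) (hB : IsSelfAdjoint B) (hB0 : B ≠ 0)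
    (c d : ℝ) (hc : 0 ≤ c) (hd : 0 < d) :
    (((∃ a : ℝ, RationalNumRange.numRange A = {a}) ∨
        (∃ b : ℝ, RationalNumRange.numRangeBdd B = {b})) →
      RationalNumRange.offAxisClosure c d (RationalNumRange.Omega A B) =
        RationalNumRange.offAxisClosure c d (frontier (RationalNumRange.Omega A B))) ∧
    (¬ ((∃ a : ℝ, RationalNumRange.numRange A = {a}) ∨
        (∃ b : ℝ, RationalNumRange.numRangeBdd B = {b})) →
      (∃! O₀ : Set RationalNumRange.Sphere,
        RationalNumRange.IsComponent
          (RationalNumRange.offAxisClosure c d (frontier (RationalNumRange.Omega A B)))ᶜ O₀ ∧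
        RationalNumRange.HasLargeImagParts O₀) ∧
      ∀ O₀ : Set RationalNumRange.Sphere,
        RationalNumRange.IsComponent
          (RationalNumRange.offAxisClosure c d (frontier (RationalNumRange.Omega A B)))ᶜ O₀ →
        RationalNumRange.HasLargeImagParts O₀ →
        ∃ n : ℕ,
          RationalNumRange.StopsAt
            (RationalNumRange.offAxisClosure c d (frontier (RationalNumRange.Omega A B)))ᶜ O₀ n ∧
          RationalNumRange.offAxisClosure c d (RationalNumRange.Omega A B) =
            (RationalNumRange.labels
              (RationalNumRange.offAxisClosure c d (frontier (RationalNumRange.Omega A B)))ᶜ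
              O₀ n).1 ∪
            RationalNumRange.offAxisClosure c d (frontier (RationalNumRange.Omega A B))) := by
  open RationalNumRange in
  refine ⟨?_, ?_⟩
  · intro h
    -- a degenerate rectangle has empty interior
    have hint : interior (Omega A B) = ∅ := by
      rw [Omega, interior_prod_eq]
      rcases h with ⟨a, ha⟩ | ⟨b, hb⟩
      · rw [ha, image_singleton, closure_singleton, interior_singleton_coe, empty_prod]
      · rw [hb, closure_singleton, interior_singleton, prod_empty]
    have hcl : IsClosed (Omega A B) := isClosed_closure.prod isClosed_closure
    rw [hcl.frontier_eq, hint, sdiff_empty]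
  · intro h
    push Not at h
    obtain ⟨hA1, hB1⟩ := h
    have hAf : A.IsFormalAdjoint A := by
      have := LinearPMap.adjoint_isFormalAdjoint hA.dense_domain
      rwa [LinearPMap.isSelfAdjoint_def.1 hA] at this
    have hBf : ((B : H →ₗ[ℂ] H).toPMap ⊤).IsFormalAdjoint ((B : H →ₗ[ℂ] H).toPMap ⊤) :=
      fun x y => hB.isSymmetric x y
    obtain ⟨v, hv⟩ : ∃ v : H, v ≠ 0 := by
      by_contra! h0
      exact hB0 (ContinuousLinearMap.ext fun x => by rw [h0 x, map_zero, map_zero])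
    have hAne : ∃ u : A.domain, u ≠ 0 := by
      by_contra! h0
      have hsub : (A.domain : Set H) ⊆ {0} := fun x hx => congrArg Subtype.val (h0 ⟨x, hx⟩)
      have := closure_mono hsub (hA.dense_domain v)
      rw [closure_singleton] at this
      exact hv this
    have hAconn : IsConnected (numRange A) :=
      ⟨numRange_nonempty hAne hAf, (ordConnected_numRange hAf).isPreconnected⟩
    have hBconn : IsConnected (numRangeBdd B) :=
      ⟨numRange_nonempty ⟨⟨v, trivial⟩, fun h0 => hv (congrArg Subtype.val h0)⟩ hBf,
        (ordConnected_numRange hBf).isPreconnected⟩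
    have hBcomp : IsCompact (closure (numRangeBdd B)) := by
      refine isCompact_Icc.of_isClosed_subset isClosed_closure
        (closure_minimal (t := Icc (-‖B‖) ‖B‖) (fun b hb => ?_) isClosed_Icc)
      exact abs_le.1 (abs_le_of_mem_numRangeBdd hb)
    obtain ⟨a₁, a₂, ha, hAcl⟩ := exists_closure_eq_Icc
      (hAconn.image _ continuous_coe_real_ereal.continuousOn) isClosed_closure.isCompact (by
        intro x hx
        obtain ⟨a, haA⟩ := hAconn.nonempty
        refine hA1 a (eq_singleton_iff_unique_mem.2 ⟨haA, fun a' ha' => ?_⟩)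
        have h1 := hx.subset (mem_image_of_mem _ haA)
        have h2 := hx.subset (mem_image_of_mem _ ha')
        exact EReal.coe_injective ((show (a' : EReal) = x from h2).trans
          (show (a : EReal) = x from h1).symm))
    obtain ⟨b₁, b₂, hb, hBcl⟩ := exists_closure_eq_Icc hBconn hBcomp hB1
    have hΩ : Omega A B = rect a₁ a₂ b₁ b₂ := by rw [Omega, hAcl, hBcl, rect]
    rw [hΩ]
    exact labelling_rect hc hd ha hb
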